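/- Let $T>0$, let $K\subseteq\mathbb R^n$ be a (nonempty) closed convex cone with positive polar cone $\tilde K=\{q\in\mathbb R^n: q'v\ge 0 \text{ for all } v\in K\}$, and let $b:[0,T]\to\mathbb R^n$ and $\sigma:[0,T]\to\mathbb R^{n\times n}$ be continuous with $\sigma(t)$ nonsingular for every $t$. Put $\theta(t)=\sigma(t)^{-1}b(t)$, let $\hat\pi(t)$ be the unique minimizer of $q\mapsto|\theta(t)+\sigma(t)^{-1}q|^2$ over $q\in\tilde K$, and put $\hat\theta(t)=\theta(t)+\sigma(t)^{-1}\hat\pi(t)$. Assume that $\hat\theta$ is continuous on $[0,T]$ and that there is $\theta_0>0$ with $|\hat\theta(t)|\ge\theta_0$ for all $t\in[0,T]$. Let $U:[0,\infty)\to\mathbb R$ be continuous, increasing and concave with $U(0)=0$, $\lim_{x\to\infty}U(x)=\infty$ and $0\le U(x)\le L(1+x^p)$ for all $x\ge 0$, where $L>0$ and $0<p<1$ are constants. Define the Hamiltonian $$H(t,x,\rho,M)=\sup_{\pi\in K}\Big\{\pi'b(t)\,x\rho+\tfrac12|\sigma(t)'\pi|^2x^2M\Big\}\in(-\infty,\infty].$$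 Then there exists a function $u\in C^0([0,T]\times[0,\infty))\cap C^{1,2}([0,T)\times(0,\infty))$ (the time derivative at $t=0$ being one-sided) such that: 1. $u$ satisfies the HJB equation $-u_t(t,x)-H(t,x,u_x(t,x),u_{xx}(t,x))=0$ for all $(t,x)\in[0,T)\times(0,\infty)$, with $u(T,x)=U(x)$ for all $x\ge0$ and $u(t,0)=0$ for all $t\in[0,T]$. 2. For every $(t,x)\in[0,T)\times(0,\infty)$ one has $u_{xx}(t,x)<0$, and the supremum defining $H(t,x,u_x(t,x),u_{xx}(t,x))$ is a maximum, attained at $$\pi^*(t,x)=-(\sigma(t)')^{-1}\hat\theta(t)\,\frac{u_x(t,x)}{x\,u_{xx}(t,x)}\in K.$$ 3. For every $t\in[0,T)$, the function $x\mapsto u(t,x)$ is strictly increasing and strictly concave on $[0,\infty)$. 4. There is a constant $C$ such that $0\le u(t,x)\le C(1+x^p)$ for all $(t,x)\in[0,T]\times[0,\infty)$. -/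

import Mathlib

open Set Filter Topology

namespace UtilityHJB

/-- Column vectors with the Euclidean norm and inner product. -/
abbrev Vec (n : ℕ) := EuclideanSpace ℝ (Fin n)

/-- Square real matrices. -/
abbrev Mat (n : ℕ) := Matrix (Fin n) (Fin n) ℝ

/-- The matrix-vector product on Euclidean space. -/
noncomputable def act {n : ℕ} (A : Mat n) (v : Vec n) : Vec n := Matrix.toEuclideanLin A v

/-- The market price of risk `θ(t) = σ(t)⁻¹ b(t)`. -/
noncomputable def theta {n : ℕ} (b : ℝ → Vec n) (σ : ℝ → Mat n) (t : ℝ) : Vec n :=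
  act (σ t)⁻¹ (b t)

/-- The positive polar cone `{q | ∀ v ∈ K, 0 ≤ q ⬝ v}`. -/
noncomputable def polar {n : ℕ} (K : ProperCone ℝ (Vec n)) : ProperCone ℝ (Vec n) :=
  ProperCone.innerDual (K : Set (Vec n))

/-- The dual objective `f(q) = |θ(t) + σ(t)⁻¹ q|²`. -/
noncomputable def dualObj {n : ℕ} (b : ℝ → Vec n) (σ : ℝ → Mat n) (t : ℝ) (q : Vec n) : ℝ :=
  ‖theta b σ t + act (σ t)⁻¹ q‖ ^ 2

/-- The minimizer of the dual objective over the positive polar cone; it exists and is unique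
when `σ(t)` is nonsingular, see `existsUnique_dualMin`. -/
noncomputable def piHat {n : ℕ} (K : ProperCone ℝ (Vec n)) (b : ℝ → Vec n) (σ : ℝ → Mat n)
    (t : ℝ) : Vec n :=
  Classical.epsilon fun q => q ∈ polar K ∧ IsMinOn (dualObj b σ t) (polar K : Set (Vec n)) q

/-- `θ̂(t) = θ(t) + σ(t)⁻¹ π̂(t)`. -/
noncomputable def thetaHat {n : ℕ} (K : ProperCone ℝ (Vec n)) (b : ℝ → Vec n) (σ : ℝ → Mat n)
    (t : ℝ) : Vec n :=
  theta b σ t + act (σ t)⁻¹ (piHat K b σ t)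

/-- The dual objective has exactly one minimizer over the polar cone. -/
theorem existsUnique_dualMin {n : ℕ} (K : ProperCone ℝ (Vec n)) (b : ℝ → Vec n) (σ : ℝ → Mat n)
    (t : ℝ) (hσ : IsUnit (σ t).det) :
    ∃! q, q ∈ polar K ∧ IsMinOn (dualObj b σ t) (polar K : Set (Vec n)) q := by
  set A : Vec n →ₗ[ℝ] Vec n := Matrix.toEuclideanLin (σ t)⁻¹ with hA
  have hinj : Function.Injective A := by
    intro v w h
    have h2 : Matrix.toEuclideanLin (σ t) (A v) = Matrix.toEuclideanLin (σ t) (A w) := by rw [h]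
    simpa [hA, Matrix.toLpLin_apply, Matrix.mul_nonsing_inv _ hσ] using h2
  have hcl : IsClosed (A '' (polar K : Set (Vec n))) :=
    (LinearMap.isClosedEmbedding_of_injective (LinearMap.ker_eq_bot.2 hinj)).isClosedMap _
      (polar K).isClosed
  have hcv : Convex ℝ (polar K : Set (Vec n)) := (polar K).toPointedCone.convex
  obtain ⟨_, ⟨q, hq, rfl⟩, hmin⟩ := exists_norm_eq_iInf_of_complete_convex
    (K := A '' (polar K : Set (Vec n))) ⟨A 0, 0, (polar K).zero_mem, rfl⟩ hcl.isComplete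
    (hcv.linear_image A) (-theta b σ t)
  have key : ∀ v, ‖-theta b σ t - A v‖ = ‖theta b σ t + A v‖ := fun v => by
    rw [← norm_neg]; congr 1; abel
  have hqmin : IsMinOn (dualObj b σ t) (polar K : Set (Vec n)) q := by
    intro w hw
    have h1 : ‖-theta b σ t - A q‖ ≤ ‖-theta b σ t - A w‖ := by
      rw [hmin]
      exact ciInf_le (f := fun w : A '' (polar K : Set (Vec n)) => ‖-theta b σ t - w‖)
        ⟨0, by rintro _ ⟨_, rfl⟩; exact norm_nonneg _⟩ ⟨A w, w, hw, rfl⟩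
    rw [key, key] at h1
    exact pow_le_pow_left₀ (norm_nonneg _) h1 2
  refine ⟨q, ⟨hq, hqmin⟩, ?_⟩
  rintro w ⟨hw, hwmin⟩
  have hm : (1 / 2 : ℝ) • q + (1 / 2 : ℝ) • w ∈ (polar K : Set (Vec n)) :=
    hcv hq hw (by norm_num) (by norm_num) (by norm_num)
  have e1 : ‖theta b σ t + A q‖ ^ 2 ≤ ‖theta b σ t + A w‖ ^ 2 := hqmin hw
  have e2 : ‖theta b σ t + A w‖ ^ 2 ≤
      ‖theta b σ t + A ((1 / 2 : ℝ) • q + (1 / 2 : ℝ) • w)‖ ^ 2 := hwmin hm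
  have e3 := parallelogram_law_with_norm ℝ (theta b σ t + A q) (theta b σ t + A w)
  have e4 : theta b σ t + A q + (theta b σ t + A w) =
      (2 : ℝ) • (theta b σ t + A ((1 / 2 : ℝ) • q + (1 / 2 : ℝ) • w)) := by
    simp only [map_add, map_smul]; module
  have e5 : theta b σ t + A q - (theta b σ t + A w) = A q - A w := by abel
  rw [e4, e5, norm_smul, Real.norm_ofNat] at e3
  have e6 : ‖A q - A w‖ = 0 := by
    have := norm_nonneg (A q - A w)
    nlinarith
  exact (hinj (sub_eq_zero.1 (norm_eq_zero.1 e6))).symm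

/-- `π̂(t)` is the minimizer of the dual objective over the polar cone. -/
theorem piHat_spec {n : ℕ} (K : ProperCone ℝ (Vec n)) (b : ℝ → Vec n) (σ : ℝ → Mat n)
    (t : ℝ) (hσ : IsUnit (σ t).det) :
    piHat K b σ t ∈ polar K ∧
      IsMinOn (dualObj b σ t) (polar K : Set (Vec n)) (piHat K b σ t) :=
  Classical.epsilon_spec (existsUnique_dualMin K b σ t hσ).exists

/-- The expression `π' b(t) x p + ½ |σ(t)' π|² x² M` inside the Hamiltonian. -/
noncomputable def hamObj {n : ℕ} (b : ℝ → Vec n) (σ : ℝ → Mat n) (t x p M : ℝ) (π : Vec n) : ℝ :=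
  inner ℝ π (b t) * x * p + 1 / 2 * ‖act (σ t).transpose π‖ ^ 2 * x ^ 2 * M

/-- The Hamiltonian `H(t,x,p,M) = sup_{π ∈ K} {π' b(t) x p + ½ |σ(t)' π|² x² M}`, a supremum
in the extended reals. -/
noncomputable def hamiltonian {n : ℕ} (K : ProperCone ℝ (Vec n)) (b : ℝ → Vec n) (σ : ℝ → Mat n)
    (t x p M : ℝ) : EReal :=
  ⨆ π ∈ K, ((hamObj b σ t x p M π : ℝ) : EReal)

/-- `u_t(t,x)`, relative to the time interval `[0,T)` (one-sided at `t = 0`). -/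
noncomputable def dt (T : ℝ) (u : ℝ → ℝ → ℝ) (t x : ℝ) : ℝ :=
  derivWithin (fun s => u s x) (Ico 0 T) t

/-- `u_x(t,x)`. -/
noncomputable def dx (u : ℝ → ℝ → ℝ) (t x : ℝ) : ℝ := deriv (fun z => u t z) x

/-- `u_xx(t,x)`. -/
noncomputable def dxx (u : ℝ → ℝ → ℝ) (t x : ℝ) : ℝ := deriv (fun z => dx u t z) x

/-- `u ∈ C^{1,2}([0,T) × (0,∞))`: the derivatives `u_t`, `u_x`, `u_xx` exist there and, like `u`,
are jointly continuous. -/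
structure IsC12 (T : ℝ) (u : ℝ → ℝ → ℝ) : Prop where
  diff_t : ∀ t ∈ Ico 0 T, ∀ x ∈ Ioi (0 : ℝ),
    DifferentiableWithinAt ℝ (fun s => u s x) (Ico 0 T) t
  diff_x : ∀ t ∈ Ico 0 T, ∀ x ∈ Ioi (0 : ℝ), DifferentiableAt ℝ (fun z => u t z) x
  diff_xx : ∀ t ∈ Ico 0 T, ∀ x ∈ Ioi (0 : ℝ), DifferentiableAt ℝ (fun z => dx u t z) x
  cont : ContinuousOn (fun q : ℝ × ℝ => u q.1 q.2) (Ico 0 T ×ˢ Ioi 0)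
  cont_t : ContinuousOn (fun q : ℝ × ℝ => dt T u q.1 q.2) (Ico 0 T ×ˢ Ioi 0)
  cont_x : ContinuousOn (fun q : ℝ × ℝ => dx u q.1 q.2) (Ico 0 T ×ˢ Ioi 0)
  cont_xx : ContinuousOn (fun q : ℝ × ℝ => dxx u q.1 q.2) (Ico 0 T ×ˢ Ioi 0)

/-- The utility function: continuous, increasing and concave on `[0,∞)`, `U(0) = 0`,
`U(∞) = ∞`, and `0 ≤ U(x) ≤ L (1 + x^p)`. -/
structure IsUtility (L p : ℝ) (U : ℝ → ℝ) : Prop where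
  cont : ContinuousOn U (Ici 0)
  mono : MonotoneOn U (Ici 0)
  concave : ConcaveOn ℝ (Ici 0) U
  zero : U 0 = 0
  tendsto_top : Tendsto U atTop atTop
  growth : ∀ x, 0 ≤ x → 0 ≤ U x ∧ U x ≤ L * (1 + x ^ p)

/-- The feedback control `π*(t,x) = -(σ(t)')⁻¹ θ̂(t) u_x(t,x) / (x u_xx(t,x))`. -/
noncomputable def piStar {n : ℕ} (K : ProperCone ℝ (Vec n)) (b : ℝ → Vec n) (σ : ℝ → Mat n)
    (u : ℝ → ℝ → ℝ) (t x : ℝ) : Vec n :=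
  (-(dx u t x / (x * dxx u t x))) • act ((σ t).transpose)⁻¹ (thetaHat K b σ t)

end UtilityHJB

/-!
The value function is built through convex duality, which linearizes the equation.

*Hamiltonian.* The first-order condition for the minimizer `π̂(t)` over the polar cone says that
`(σ(t)')⁻¹ θ̂(t)` lies in the bipolar cone `K` and is orthogonal to `π̂(t)`. Completing the square,
for `ρ > 0 > M` the supremum over `K` equals `-½ |θ̂(t)|² ρ² / M` and is attained at the feedback
control (`hamiltonian_eq`, `hamObj_le`, `hamObj_feedback`). The HJB equation thus reads
`u_t = ½ |θ̂(t)|² u_x² / u_xx`, and the time change `s = ∫_t^T |θ̂|²` (`remVar`) removes the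
coefficient.

*Dual problem.* Let `f(y) = sup_x (U(x) - x y)` be the conjugate of the utility (`conj`). The dual
value function `v(s,y) = E[f(y Z)]`, with `log Z` normal of mean `-s/2` and variance `s`
(`dualVal`), solves the linear equation `v_s = ½ y² v_yy`. Its regularity follows from
differentiation under the integral sign of the two-parameter transform
`∫ wᵐ exp(α w - β w²) g(w) dw` (`ExpGrowth.hasFDerivAt_laplace`). Strict convexity, although
`f` is merely convex, comes from `curvature_pos`: the kernel of `v_yy` is a Gaussian times a quadratic with two real roots and
annihilates affine functions of `y`, so subtracting from `f` its chord through the two roots makes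
the integrand nonnegative, and it does not vanish identically because `f` is not affine.

*Inversion.* The function `u(t,x) = inf_y (v(s,y) + x y)` is attained where `v_y = -x`. The envelope
theorem gives `u_x = y`, `u_xx = -1 / v_yy`, `u_s = v_s` (`ConvexFlow`), which is the primal
equation. At the boundary `s = 0` or `x = 0` continuity follows by comparison: `u` is an infimum of
continuous functions, `u ≥ U` since `Z` has mean one, and the two sides agree on the boundary
because `U` is its own biconjugate and `f` vanishes at infinity.
-/

namespace UtilityHJB

/-! ### The Hamiltonian -/

section Hamiltonian

variable {n : ℕ}

lemma act_add (A : Mat n) (v w : Vec n) : act A (v + w) = act A v + act A w := map_add _ _ _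

lemma act_smul (A : Mat n) (c : ℝ) (v : Vec n) : act A (c • v) = c • act A v := map_smul _ _ _

lemma act_act (A B : Mat n) (v : Vec n) : act A (act B v) = act (A * B) v := by
  simp [act, Matrix.toLpLin_apply]

lemma act_one (v : Vec n) : act (1 : Mat n) v = v := by
  simp [act]

lemma inner_act_left (A : Mat n) (v w : Vec n) :
    inner ℝ (act A v) w = inner ℝ v (act A.transpose w) := by
  rw [act, act, ← Matrix.conjTranspose_eq_transpose_of_trivial,
    Matrix.toEuclideanLin_conjTranspose_eq_adjoint, LinearMap.adjoint_inner_right]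

lemma act_inv_transpose {S : Mat n} (hS : IsUnit S.det) (v : Vec n) :
    act S.transpose (act S.transpose⁻¹ v) = v := by
  rw [act_act, Matrix.mul_nonsing_inv _ (by rwa [Matrix.det_transpose]), act_one]

lemma inner_eq_inner_act_transpose {S : Mat n} (hS : IsUnit S.det) (v w : Vec n) :
    inner ℝ v w = inner ℝ (act S.transpose v) (act S⁻¹ w) := by
  rw [inner_act_left, Matrix.transpose_transpose, act_act, Matrix.mul_nonsing_inv _ hS, act_one]

variable (K : ProperCone ℝ (Vec n)) (b : ℝ → Vec n) (σ : ℝ → Mat n) (t : ℝ)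

/-- The first-order condition for the minimizer of the dual objective. -/
lemma inner_thetaHat_nonneg (hσ : IsUnit (σ t).det) {q : Vec n} (hq : q ∈ polar K) :
    0 ≤ inner ℝ (thetaHat K b σ t) (act (σ t)⁻¹ (q - piHat K b σ t)) := by
  obtain ⟨hm, hmin⟩ := piHat_spec K b σ t hσ
  have hcv : Convex ℝ (polar K : Set (Vec n)) := (polar K).toPointedCone.convex
  set d := act (σ t)⁻¹ (q - piHat K b σ t) with hd
  by_contra! hneg
  have key : ∀ r : ℝ, 0 ≤ r → r ≤ 1 →
      0 ≤ 2 * r * inner ℝ (thetaHat K b σ t) d + r ^ 2 * ‖d‖ ^ 2 := by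
    intro r h0 h1
    have hmem : piHat K b σ t + r • (q - piHat K b σ t) ∈ (polar K : Set (Vec n)) :=
      hcv.add_smul_sub_mem hm hq ⟨h0, h1⟩
    have h2 : dualObj b σ t (piHat K b σ t) ≤
        dualObj b σ t (piHat K b σ t + r • (q - piHat K b σ t)) := hmin hmem
    unfold dualObj at h2
    rw [act_add, act_smul, ← hd, ← add_assoc] at h2
    change ‖thetaHat K b σ t‖ ^ 2 ≤ ‖thetaHat K b σ t + r • d‖ ^ 2 at h2
    rw [norm_add_sq_real, inner_smul_right, norm_smul, mul_pow, Real.norm_eq_abs, sq_abs] at h2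
    linarith
  set c := inner ℝ (thetaHat K b σ t) d
  -- a step short enough for the linear term to dominate the quadratic one
  have hD : 0 < ‖d‖ ^ 2 - c := by nlinarith [sq_nonneg ‖d‖]
  obtain ⟨r, hr⟩ : ∃ r, r = -c / (‖d‖ ^ 2 - c) := ⟨_, rfl⟩
  have hrD : r * (‖d‖ ^ 2 - c) = -c := by rw [hr]; field_simp
  have hr0 : 0 < r := hr ▸ div_pos (by linarith) hD
  have hr1 : r ≤ 1 := hr ▸ (div_le_one hD).2 (by nlinarith [sq_nonneg ‖d‖])
  have h := key r hr0.le hr1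
  have e : 2 * r * c + r ^ 2 * ‖d‖ ^ 2 = r * c * (1 + r) := by linear_combination r * hrD
  nlinarith [mul_pos hr0 (neg_pos.2 hneg)]

/-- The candidate portfolio direction `(σ')⁻¹ θ̂`. -/
noncomputable def feedbackDir : Vec n := act (σ t).transpose⁻¹ (thetaHat K b σ t)

lemma inner_feedbackDir (q : Vec n) :
    inner ℝ (feedbackDir K b σ t) q = inner ℝ (thetaHat K b σ t) (act (σ t)⁻¹ q) := by
  rw [feedbackDir, inner_act_left, Matrix.transpose_nonsing_inv, Matrix.transpose_transpose]

/-- Complementary slackness: `θ̂` is orthogonal to `σ⁻¹ π̂`. -/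
lemma inner_feedbackDir_piHat (hσ : IsUnit (σ t).det) :
    inner ℝ (feedbackDir K b σ t) (piHat K b σ t) = 0 := by
  have hm := (piHat_spec K b σ t hσ).1
  have h0 := inner_thetaHat_nonneg K b σ t hσ (polar K).zero_mem
  have h2 := inner_thetaHat_nonneg K b σ t hσ ((polar K).add_mem hm hm)
  rw [← inner_feedbackDir] at h0 h2
  rw [zero_sub, inner_neg_right] at h0
  rw [add_sub_cancel_right] at h2
  linarith

lemma feedbackDir_mem (hσ : IsUnit (σ t).det) : feedbackDir K b σ t ∈ K := by
  suffices feedbackDir K b σ t ∈ ProperCone.innerDual (polar K : Set (Vec n)) by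
    rwa [polar, ProperCone.innerDual_innerDual] at this
  rw [ProperCone.mem_innerDual]
  intro q hq
  have h := inner_thetaHat_nonneg K b σ t hσ hq
  rw [← inner_feedbackDir, inner_sub_right, inner_feedbackDir_piHat K b σ t hσ] at h
  rw [real_inner_comm]
  linarith

/-- The drift `π' b` in terms of `θ̂`; the last term is nonnegative for `π ∈ K`. -/
lemma inner_drift_eq (hσ : IsUnit (σ t).det) (π : Vec n) :
    inner ℝ π (b t) = inner ℝ (act (σ t).transpose π) (thetaHat K b σ t)
      - inner ℝ π (piHat K b σ t) := by
  rw [inner_eq_inner_act_transpose hσ π (b t), inner_eq_inner_act_transpose hσ π (piHat K b σ t),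
    thetaHat, inner_add_right, theta]
  ring

/-- The upper bound for the Hamiltonian: `π' b ≤ (σ' π)' θ̂` on `K`, then complete the square. -/
lemma hamObj_le (hσ : IsUnit (σ t).det) {x c M : ℝ} (hx : 0 < x) (hc : 0 < c) (hM : M < 0)
    {π : Vec n} (hπ : π ∈ K) :
    hamObj b σ t x c M π ≤ -(1 / 2) * ‖thetaHat K b σ t‖ ^ 2 * c ^ 2 / M := by
  have hp : 0 ≤ inner ℝ π (piHat K b σ t) := (piHat_spec K b σ t hσ).1 hπ
  have hsq : 0 ≤ ‖act (σ t).transpose π + (c / (x * M)) • thetaHat K b σ t‖ ^ 2 := sq_nonneg _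
  rw [norm_add_sq_real, inner_smul_right, norm_smul, mul_pow, Real.norm_eq_abs, sq_abs] at hsq
  rw [hamObj, inner_drift_eq K b σ t hσ]
  set I := inner ℝ (act (σ t).transpose π) (thetaHat K b σ t)
  set N := ‖act (σ t).transpose π‖ ^ 2
  set Θ := ‖thetaHat K b σ t‖ ^ 2
  have h1 : 0 ≤ inner ℝ π (piHat K b σ t) * x * c := by positivity
  have h2 := mul_nonneg hsq (mul_nonneg (sq_nonneg x) (neg_nonneg.2 hM.le))
  have h3 : (N + 2 * (c / (x * M) * I) + (c / (x * M)) ^ 2 * Θ) * (x ^ 2 * -M)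
      = -(N * x ^ 2 * M + 2 * I * x * c + Θ * c ^ 2 / M) := by
    have := hM.ne
    field_simp
  have h4 : -(1 / 2) * Θ * c ^ 2 / M = -(1 / 2) * (Θ * c ^ 2 / M) := by ring
  rw [h4]
  linarith

lemma hamObj_feedback (hσ : IsUnit (σ t).det) {x c M : ℝ} (hx : 0 < x) (hM : M < 0) :
    hamObj b σ t x c M ((-(c / (x * M))) • feedbackDir K b σ t) =
      -(1 / 2) * ‖thetaHat K b σ t‖ ^ 2 * c ^ 2 / M := by
  rw [hamObj, inner_drift_eq K b σ t hσ, real_inner_smul_left, inner_feedbackDir_piHat K b σ t hσ,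
    act_smul, feedbackDir, act_inv_transpose hσ, real_inner_smul_left, norm_smul,
    real_inner_self_eq_norm_sq, mul_pow, Real.norm_eq_abs, sq_abs]
  have := hM.ne
  field_simp
  ring

lemma feedback_mem (hσ : IsUnit (σ t).det) {x c M : ℝ} (hx : 0 < x) (hc : 0 < c) (hM : M < 0) :
    (-(c / (x * M))) • feedbackDir K b σ t ∈ K := by
  have h : 0 ≤ -(c / (x * M)) := by
    rw [← div_neg]
    exact div_nonneg hc.le (by nlinarith)
  exact K.smul_mem (feedbackDir_mem K b σ t hσ) h

lemma hamiltonian_eq (hσ : IsUnit (σ t).det) {x c M : ℝ} (hx : 0 < x) (hc : 0 < c)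
    (hM : M < 0) :
    hamiltonian K b σ t x c M =
      ((-(1 / 2) * ‖thetaHat K b σ t‖ ^ 2 * c ^ 2 / M : ℝ) : EReal) := by
  refine le_antisymm (iSup₂_le fun π hπ => ?_) ?_
  · exact EReal.coe_le_coe_iff.2 (hamObj_le K b σ t hσ hx hc hM hπ)
  · rw [← hamObj_feedback K b σ t hσ hx hM]
    exact le_iSup₂ (f := fun π (_ : π ∈ K) => ((hamObj b σ t x c M π : ℝ) : EReal)) _
      (feedback_mem K b σ t hσ hx hc hM)

end Hamiltonian

/-! ### The convex conjugate of the utility -/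

section Conjugate

/-- The convex conjugate `sup_{x ≥ 0} (U x - x y)` of a utility function. -/
noncomputable def conj (U : ℝ → ℝ) (y : ℝ) : ℝ := ⨆ x : Ici (0 : ℝ), (U x - x * y)

variable {L p : ℝ} {U : ℝ → ℝ}

/-- Beyond `x = (L / y) ^ (1 / (1 - p))` the linear cost dominates `L x ^ p`. -/
lemma utility_sub_le (hL : 0 < L) (hp0 : 0 < p) (hp1 : p < 1) (hU : IsUtility L p U) {x y : ℝ}
    (hx : 0 ≤ x) (hy : 0 < y) :
    U x - x * y ≤ L + L * L ^ (p / (1 - p)) * y ^ (-(p / (1 - p))) := by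
  have h1 := (hU.growth x hx).2
  have hq : 0 < 1 - p := by linarith
  have hLy : 0 < L / y := div_pos hL hy
  have e1 : L ^ (p / (1 - p)) * y ^ (-(p / (1 - p))) = (L / y) ^ (p / (1 - p)) := by
    rw [Real.rpow_neg hy.le, Real.div_rpow hL.le hy.le, ← div_eq_mul_inv]
  rw [mul_assoc, e1]
  have hpos : 0 ≤ L * (L / y) ^ (p / (1 - p)) := by positivity
  rcases le_total x ((L / y) ^ (1 / (1 - p))) with h | h
  · have h2 : x ^ p ≤ (L / y) ^ (p / (1 - p)) := by
      calc x ^ p ≤ ((L / y) ^ (1 / (1 - p))) ^ p := Real.rpow_le_rpow hx h hp0.le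
        _ = _ := by rw [← Real.rpow_mul hLy.le]; congr 1; ring
    nlinarith [mul_le_mul_of_nonneg_left h2 hL.le, mul_nonneg hx hy.le]
  · have hx0 : 0 < x := lt_of_lt_of_le (Real.rpow_pos_of_pos hLy _) h
    have h2 : L / y ≤ x ^ (1 - p) := by
      calc L / y = ((L / y) ^ (1 / (1 - p))) ^ (1 - p) := by
            rw [← Real.rpow_mul hLy.le, one_div_mul_cancel hq.ne', Real.rpow_one]
        _ ≤ _ := Real.rpow_le_rpow (by positivity) h hq.le
    have h3 : x ^ p * x ^ (1 - p) = x := by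
      rw [← Real.rpow_add hx0]; simp
    have h4 : L ≤ x ^ (1 - p) * y := (div_le_iff₀ hy).1 h2
    have h5 : L * x ^ p ≤ x * y := by
      calc L * x ^ p ≤ x ^ (1 - p) * y * x ^ p :=
            mul_le_mul_of_nonneg_right h4 (by positivity)
        _ = x ^ p * x ^ (1 - p) * y := by ring
        _ = _ := by rw [h3]
    linarith

lemma bddAbove_conj (hL : 0 < L) (hp0 : 0 < p) (hp1 : p < 1) (hU : IsUtility L p U) {y : ℝ}
    (hy : 0 < y) : BddAbove (range fun x : Ici (0 : ℝ) => U x - x * y) :=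
  ⟨_, by rintro _ ⟨x, rfl⟩; exact utility_sub_le hL hp0 hp1 hU x.2 hy⟩

lemma sub_le_conj (hL : 0 < L) (hp0 : 0 < p) (hp1 : p < 1) (hU : IsUtility L p U) {x y : ℝ}
    (hx : 0 ≤ x) (hy : 0 < y) : U x - x * y ≤ conj U y :=
  le_ciSup (bddAbove_conj hL hp0 hp1 hU hy) (⟨x, hx⟩ : Ici (0 : ℝ))

lemma conj_le {y B : ℝ} (h : ∀ x, 0 ≤ x → U x - x * y ≤ B) : conj U y ≤ B :=
  have : Nonempty (Ici (0 : ℝ)) := ⟨⟨0, self_mem_Ici⟩⟩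
  ciSup_le fun x => h x x.2

lemma conj_nonneg (hL : 0 < L) (hp0 : 0 < p) (hp1 : p < 1) (hU : IsUtility L p U) {y : ℝ}
    (hy : 0 < y) : 0 ≤ conj U y := by
  simpa [hU.zero] using sub_le_conj hL hp0 hp1 hU le_rfl hy

lemma convexOn_conj (hL : 0 < L) (hp0 : 0 < p) (hp1 : p < 1) (hU : IsUtility L p U) :
    ConvexOn ℝ (Ioi 0) (conj U) := by
  refine ⟨convex_Ioi 0, fun y hy z hz a b ha hb hab => conj_le fun x hx => ?_⟩
  have h1 := mul_le_mul_of_nonneg_left (sub_le_conj hL hp0 hp1 hU hx hy) ha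
  have h2 := mul_le_mul_of_nonneg_left (sub_le_conj hL hp0 hp1 hU hx hz) hb
  simp only [smul_eq_mul]
  have : U x = a * U x + b * U x := by rw [← add_mul, hab, one_mul]
  nlinarith

/-- Every interior point of the domain of the utility has a supergradient. It is positive since
the utility is unbounded. -/
lemma exists_supergradient (hU : IsUtility L p U) {x : ℝ} (hx : 0 < x) :
    ∃ y, 0 < y ∧ ∀ z, 0 ≤ z → U z - z * y ≤ U x - x * y := by
  have hc : ConvexOn ℝ (Ici 0) (-U) := hU.concave.neg
  have hxi : x ∈ interior (Ici (0 : ℝ)) := by rwa [interior_Ici]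
  have key : ∀ z, 0 ≤ z → U z ≤ U x + (z - x) * (-derivWithin (-U) (Ioi x) x) := by
    intro z hz
    rcases lt_trichotomy z x with h | rfl | h
    · have h1 := (hc.slope_le_leftDeriv_of_mem_interior hz hxi h).trans
        (hc.leftDeriv_le_rightDeriv_of_mem_interior hxi)
      rw [slope_def_field, div_le_iff₀ (by linarith)] at h1
      simp only [Pi.neg_apply] at h1
      linarith
    · simp
    · have h1 := hc.rightDeriv_le_slope_of_mem_interior hxi hz h
      rw [slope_def_field, le_div_iff₀ (by linarith)] at h1
      simp only [Pi.neg_apply] at h1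
      linarith
  refine ⟨-derivWithin (-U) (Ioi x) x, ?_, fun z hz => by linarith [key z hz]⟩
  by_contra! hn
  obtain ⟨z, hz1, hz2⟩ :=
    ((hU.tendsto_top.eventually_gt_atTop (U x)).and (eventually_ge_atTop x)).exists
  nlinarith [key z (hx.le.trans hz2)]

/-- The biconjugate inequality: the conjugate is attained at a supergradient. -/
lemma exists_conj_add_le (hU : IsUtility L p U) {x : ℝ} (hx : 0 < x) :
    ∃ y, 0 < y ∧ conj U y + x * y ≤ U x := by
  obtain ⟨y, hy, h⟩ := exists_supergradient hU hx
  exact ⟨y, hy, by linarith [conj_le (U := U) h]⟩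

/-- The conjugate is arbitrarily small at infinity, since the utility is continuous at `0`. -/
lemma exists_conj_le (hU : IsUtility L p U) {ε : ℝ} (hε : 0 < ε) :
    ∃ y₀, 0 < y₀ ∧ ∀ y, y₀ ≤ y → conj U y ≤ ε := by
  have h0 : Tendsto U (𝓝[≥] 0) (𝓝 0) := by
    simpa [ContinuousWithinAt, hU.zero] using hU.cont 0 self_mem_Ici
  obtain ⟨x, hxε, hx⟩ : ∃ x, U x < ε ∧ 0 < x := by
    have h1 : ∀ᶠ x in 𝓝[>] (0 : ℝ), U x < ε :=
      (h0.mono_left (nhdsWithin_mono _ Ioi_subset_Ici_self)).eventually_lt_const hε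
    exact (h1.and self_mem_nhdsWithin).exists
  obtain ⟨y₀, hy₀, h⟩ := exists_supergradient hU hx
  refine ⟨y₀, hy₀, fun y hy => conj_le fun z hz => ?_⟩
  nlinarith [h z hz]

end Conjugate

/-! ### Gaussian-weighted two-parameter Laplace transforms -/

section Laplace

/-- Continuous functions of at most exponential growth. -/
structure ExpGrowth (g : ℝ → ℝ) : Prop where
  cont : Continuous g
  bound : ∃ C q : ℝ, 0 ≤ C ∧ 0 ≤ q ∧ ∀ w, |g w| ≤ C * Real.exp (q * |w|)

/-- The integrand `w ^ m exp (α w - β w²) g w`. -/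
noncomputable def laplaceKer (g : ℝ → ℝ) (m : ℕ) (α β w : ℝ) : ℝ :=
  w ^ m * Real.exp (α * w - β * w ^ 2) * g w

/-- The transform `∫ w ^ m exp (α w - β w²) g w dw`, convergent for `β > 0`. -/
noncomputable def laplace (g : ℝ → ℝ) (m : ℕ) (α β : ℝ) : ℝ := ∫ w, laplaceKer g m α β w

variable {g : ℝ → ℝ}

lemma ExpGrowth.continuous_laplaceKer (hg : ExpGrowth g) (m : ℕ) (α β : ℝ) :
    Continuous (laplaceKer g m α β) := by
  have := hg.cont
  unfold laplaceKer
  fun_prop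

/-- Near `(α, β)` with `β > 0` the integrand is dominated by one Gaussian: the polynomial factor
is absorbed by an exponential and the exponential by half of the quadratic term. -/
lemma ExpGrowth.exists_laplaceKer_le (hg : ExpGrowth g) (m : ℕ) (R : ℝ) {β₀ : ℝ}
    (hβ₀ : 0 < β₀) : ∃ B : ℝ, 0 ≤ B ∧ ∀ α β w, |α| ≤ R → β₀ ≤ β →
      |laplaceKer g m α β w| ≤ B * Real.exp (-(β₀ / 2) * w ^ 2) := by
  obtain ⟨C, q, hC, hq, hb⟩ := hg.bound
  refine ⟨C * m.factorial * Real.exp ((R + q + 1) ^ 2 / (2 * β₀)), by positivity,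
    fun α β w hα hβ => ?_⟩
  have h1 : |w| ^ m ≤ m.factorial * Real.exp |w| := by
    have := Real.pow_div_factorial_le_exp |w| (abs_nonneg w) m
    rwa [div_le_iff₀' (by positivity)] at this
  have h2 : Real.exp (α * w - β * w ^ 2) ≤ Real.exp (R * |w| - β₀ * w ^ 2) := by
    refine Real.exp_le_exp.2 ?_
    have h3 : α * w ≤ R * |w| := (le_abs_self _).trans
      (by rw [abs_mul]; exact mul_le_mul_of_nonneg_right hα (abs_nonneg w))
    nlinarith [mul_le_mul_of_nonneg_right hβ (sq_nonneg w)]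
  have h4 : |w| + (R * |w| - β₀ * w ^ 2) + q * |w| ≤
      (R + q + 1) ^ 2 / (2 * β₀) + -(β₀ / 2) * w ^ 2 := by
    have h5 : (R + q + 1) ^ 2 / (2 * β₀) + -(β₀ / 2) * w ^ 2 -
        (|w| + (R * |w| - β₀ * w ^ 2) + q * |w|) = (R + q + 1 - β₀ * |w|) ^ 2 / (2 * β₀) := by
      rw [← sq_abs w]; field_simp; ring
    have : 0 ≤ (R + q + 1 - β₀ * |w|) ^ 2 / (2 * β₀) := by positivity
    linarith
  calc |laplaceKer g m α β w| = |w| ^ m * Real.exp (α * w - β * w ^ 2) * |g w| := by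
        rw [laplaceKer, abs_mul, abs_mul, abs_pow, Real.abs_exp]
    _ ≤ (m.factorial * Real.exp |w|) * Real.exp (R * |w| - β₀ * w ^ 2) *
          (C * Real.exp (q * |w|)) := by gcongr; exact hb w
    _ = C * m.factorial * Real.exp (|w| + (R * |w| - β₀ * w ^ 2) + q * |w|) := by
        rw [Real.exp_add, Real.exp_add]; ring
    _ ≤ C * m.factorial *
          Real.exp ((R + q + 1) ^ 2 / (2 * β₀) + -(β₀ / 2) * w ^ 2) := by gcongr
    _ = _ := by rw [Real.exp_add]; ring

lemma ExpGrowth.integrable_laplaceKer (hg : ExpGrowth g) (m : ℕ) (α : ℝ) {β : ℝ} (hβ : 0 < β) :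
    MeasureTheory.Integrable (laplaceKer g m α β) := by
  obtain ⟨B, -, h⟩ := hg.exists_laplaceKer_le m |α| hβ
  exact ((integrable_exp_neg_mul_sq (half_pos hβ)).const_mul B).mono'
    (hg.continuous_laplaceKer m α β).aestronglyMeasurable
    (.of_forall fun w => h α β w le_rfl le_rfl)

/-- Differentiation in `α` raises the moment by one, differentiation in `β` by two. -/
lemma ExpGrowth.hasFDerivAt_laplace (hg : ExpGrowth g) (m : ℕ) (α : ℝ) {β : ℝ} (hβ : 0 < β) :
    HasFDerivAt (fun q : ℝ × ℝ => laplace g m q.1 q.2)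
      (laplace g (m + 1) α β • ContinuousLinearMap.fst ℝ ℝ ℝ -
        laplace g (m + 2) α β • ContinuousLinearMap.snd ℝ ℝ ℝ) (α, β) := by
  obtain ⟨B₁, hB₁, h1⟩ := hg.exists_laplaceKer_le (m + 1) (|α| + 1) (half_pos hβ)
  obtain ⟨B₂, hB₂, h2⟩ := hg.exists_laplaceKer_le (m + 2) (|α| + 1) (half_pos hβ)
  set F' : ℝ × ℝ → ℝ → ℝ × ℝ →L[ℝ] ℝ := fun q w =>
    laplaceKer g (m + 1) q.1 q.2 w • ContinuousLinearMap.fst ℝ ℝ ℝ -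
      laplaceKer g (m + 2) q.1 q.2 w • ContinuousLinearMap.snd ℝ ℝ ℝ with hF'
  set s : Set (ℝ × ℝ) := {q | |q.1| < |α| + 1 ∧ β / 2 < q.2} with hs
  have hsn : s ∈ 𝓝 (α, β) := by
    refine IsOpen.mem_nhds ?_ ⟨by simp, by simpa using hβ⟩
    exact (isOpen_lt (f := fun q : ℝ × ℝ => |q.1|) (by fun_prop) continuous_const).inter
      (isOpen_lt continuous_const continuous_snd)
  have key := hasFDerivAt_integral_of_dominated_of_fderiv_le (𝕜 := ℝ)
    (μ := MeasureTheory.volume) (F := fun q : ℝ × ℝ => laplaceKer g m q.1 q.2) (F' := F')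
    (x₀ := (α, β)) (s := s)
    (bound := fun w => B₁ * Real.exp (-(β / 2 / 2) * w ^ 2) + B₂ * Real.exp (-(β / 2 / 2) * w ^ 2))
    hsn
    (.of_forall fun q => (hg.continuous_laplaceKer m _ _).aestronglyMeasurable)
    (hg.integrable_laplaceKer m α hβ)
    (by
      have c1 := hg.continuous_laplaceKer (m + 1) α β
      have c2 := hg.continuous_laplaceKer (m + 2) α β
      exact (by fun_prop : Continuous (F' (α, β))).aestronglyMeasurable)
    (.of_forall fun w q hq => ?_) ?_ (.of_forall fun w q _ => ?_)
  · have e : ∫ w, F' (α, β) w = laplace g (m + 1) α β • ContinuousLinearMap.fst ℝ ℝ ℝ -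
        laplace g (m + 2) α β • ContinuousLinearMap.snd ℝ ℝ ℝ := by
      rw [hF']
      dsimp only
      rw [MeasureTheory.integral_sub ((hg.integrable_laplaceKer (m + 1) α hβ).smul_const _)
        ((hg.integrable_laplaceKer (m + 2) α hβ).smul_const _), integral_smul_const,
        integral_smul_const]
      rfl
    rw [e] at key
    exact key
  · refine (norm_sub_le _ _).trans (add_le_add ?_ ?_)
    · rw [norm_smul]
      refine (mul_le_of_le_one_right (norm_nonneg _) (ContinuousLinearMap.norm_fst_le ..)).trans ?_
      exact h1 q.1 q.2 w hq.1.le hq.2.le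
    · rw [norm_smul]
      refine (mul_le_of_le_one_right (norm_nonneg _) (ContinuousLinearMap.norm_snd_le ..)).trans ?_
      exact h2 q.1 q.2 w hq.1.le hq.2.le
  · have := integrable_exp_neg_mul_sq (half_pos (half_pos hβ))
    exact (this.const_mul _).add (this.const_mul _)
  · have h : HasFDerivAt (fun q : ℝ × ℝ => q.1 * w - q.2 * w ^ 2)
        (w • ContinuousLinearMap.fst ℝ ℝ ℝ - w ^ 2 • ContinuousLinearMap.snd ℝ ℝ ℝ) q :=
      (hasFDerivAt_fst.mul_const w).sub (hasFDerivAt_snd.mul_const (w ^ 2))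
    refine ((h.exp.const_mul (w ^ m)).mul_const (g w)).congr_fderiv ?_
    ext <;> simp [hF', laplaceKer] <;> ring

end Laplace

/-! ### Lognormal means -/

section LogMean

open ProbabilityTheory MeasureTheory

/-- The mean of `g (log Z)`, where `log Z` is normal with mean `ℓ - s / 2` and variance `s`, so
that `Z` is lognormal with mean `exp ℓ`. For `s = 0` this is `g ℓ`. -/
noncomputable def logMean (g : ℝ → ℝ) (s ℓ : ℝ) : ℝ :=
  ∫ ξ, g (ℓ - s / 2 + √s * ξ) ∂gaussianReal 0 1

/-- The density-weighted moments `∫ w ^ m g w φ(w) dw`, where `φ` is the density of the normal law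
with mean `ℓ - s / 2` and variance `s > 0`, expressed through `laplace` by expanding the
square in the exponent of `φ`. -/
noncomputable def moment (g : ℝ → ℝ) (m : ℕ) (s ℓ : ℝ) : ℝ :=
  (√(2 * Real.pi * s))⁻¹ * Real.exp (-(ℓ - s / 2) ^ 2 / (2 * s)) *
    laplace g m (ℓ / s - 1 / 2) (1 / (2 * s))

variable {g : ℝ → ℝ}

lemma logMean_zero (g : ℝ → ℝ) (ℓ : ℝ) : logMean g 0 ℓ = g ℓ := by
  simp [logMean]

/-- The lognormal mean against the Gaussian density, available only for `s > 0`. -/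
lemma logMean_eq_moment (hg : Continuous g) {s : ℝ} (hs : 0 < s) (ℓ : ℝ) :
    logMean g s ℓ = moment g 0 s ℓ := by
  have hv : s.toNNReal ≠ 0 := (Real.toNNReal_pos.2 hs).ne'
  have hmap : (gaussianReal 0 1).map (fun ξ => √s * ξ + (ℓ - s / 2)) =
      gaussianReal (ℓ - s / 2) s.toNNReal := by
    have h1 := gaussianReal_map_const_mul (μ := 0) (v := 1) (√s)
    have h2 := gaussianReal_map_add_const (μ := √s * 0)
      (v := NNReal.mk (√s ^ 2) (sq_nonneg _) * 1) (ℓ - s / 2)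
    rw [← h1, Measure.map_map (by fun_prop) (by fun_prop)] at h2
    refine h2.trans ?_
    congr 1
    · ring
    · ext; simp [Real.sq_sqrt hs.le, hs.le]
  have h3 : logMean g s ℓ = ∫ w, g w ∂gaussianReal (ℓ - s / 2) s.toNNReal := by
    rw [← hmap, integral_map (by fun_prop) hg.aestronglyMeasurable]
    simp only [logMean, add_comm]
  rw [h3, integral_gaussianReal_eq_integral_smul hv, moment, laplace, ← integral_const_mul]
  refine integral_congr_ae (.of_forall fun w => ?_)
  simp only [gaussianPDFReal, smul_eq_mul, laplaceKer, pow_zero, one_mul, Real.coe_toNNReal s hs.le]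
  have e : -(w - (ℓ - s / 2)) ^ 2 / (2 * s) = -(ℓ - s / 2) ^ 2 / (2 * s) +
      ((ℓ / s - 1 / 2) * w - 1 / (2 * s) * w ^ 2) := by field_simp; ring
  rw [e, Real.exp_add]
  ring

lemma ExpGrowth.hasFDerivAt_moment (hg : ExpGrowth g) (m : ℕ) {s : ℝ} (hs : 0 < s) (ℓ : ℝ) :
    HasFDerivAt (fun q : ℝ × ℝ => moment g m q.1 q.2)
      (((-1 / (2 * s) + ℓ ^ 2 / (2 * s ^ 2) - 1 / 8) * moment g m s ℓ -
          ℓ / s ^ 2 * moment g (m + 1) s ℓ + 1 / (2 * s ^ 2) * moment g (m + 2) s ℓ) •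
          ContinuousLinearMap.fst ℝ ℝ ℝ +
        ((moment g (m + 1) s ℓ - (ℓ - s / 2) * moment g m s ℓ) / s) •
          ContinuousLinearMap.snd ℝ ℝ ℝ) (s, ℓ) := by
  have hsq : 0 < 2 * Real.pi * s := by positivity
  have d1 : HasFDerivAt (fun q : ℝ × ℝ => q.1) (ContinuousLinearMap.fst ℝ ℝ ℝ) (s, ℓ) :=
    hasFDerivAt_fst
  have d2 : HasFDerivAt (fun q : ℝ × ℝ => q.2) (ContinuousLinearMap.snd ℝ ℝ ℝ) (s, ℓ) :=
    hasFDerivAt_snd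
  have dr : HasDerivAt (fun r : ℝ => (√(2 * Real.pi * r))⁻¹)
      (-(1 / (2 * s)) * (√(2 * Real.pi * s))⁻¹) s := by
    have h := (((hasDerivAt_id s).const_mul (2 * Real.pi)).sqrt hsq.ne').inv
      (Real.sqrt_pos.2 hsq).ne'
    refine h.congr_deriv ?_
    have h2 := Real.sq_sqrt hsq.le
    have h3 := (Real.sqrt_pos.2 hsq).ne'
    simp only [id]
    field_simp
    rw [h2]
  have dR := dr.comp_hasFDerivAt (s, ℓ) d1
  have dz : HasFDerivAt (fun q : ℝ × ℝ => -(q.2 - q.1 / 2) ^ 2 / (2 * q.1))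
      ((ℓ ^ 2 / (2 * s ^ 2) - 1 / 8) • ContinuousLinearMap.fst ℝ ℝ ℝ -
        ((ℓ - s / 2) / s) • ContinuousLinearMap.snd ℝ ℝ ℝ) (s, ℓ) := by
    have h := (((d2.sub (d1.mul_const (1 / 2))).pow 2).neg).mul
      ((hasDerivAt_inv (by positivity : (2 * s) ≠ 0)).comp_hasFDerivAt (s, ℓ) (d1.const_mul 2))
    refine (h.congr_of_eventuallyEq (.of_forall fun q => ?_)).congr_fderiv ?_
    · simp [div_eq_mul_inv]
    · ext
      · simp; field_simp; ring
      · simp; field_simp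
  have dα : HasFDerivAt (fun q : ℝ × ℝ => q.2 / q.1 - 1 / 2)
      ((-(ℓ / s ^ 2)) • ContinuousLinearMap.fst ℝ ℝ ℝ +
        (1 / s) • ContinuousLinearMap.snd ℝ ℝ ℝ) (s, ℓ) := by
    have h := (d2.mul ((hasDerivAt_inv hs.ne').comp_hasFDerivAt (s, ℓ) d1)).sub_const (1 / 2)
    refine (h.congr_of_eventuallyEq (.of_forall fun q => ?_)).congr_fderiv ?_
    · simp [div_eq_mul_inv]
    · ext
      · simp; field_simp
      · simp
  have dβ : HasFDerivAt (fun q : ℝ × ℝ => 1 / (2 * q.1))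
      ((-(1 / (2 * s ^ 2))) • ContinuousLinearMap.fst ℝ ℝ ℝ) (s, ℓ) := by
    have h := (hasDerivAt_inv (by positivity : (2 * s) ≠ 0)).comp_hasFDerivAt (s, ℓ)
      (d1.const_mul 2)
    refine (h.congr_of_eventuallyEq (.of_forall fun q => ?_)).congr_fderiv ?_
    · simp [div_eq_mul_inv]
    · ext
      · simp; field_simp
      · simp
  have dL := (hg.hasFDerivAt_laplace m (ℓ / s - 1 / 2) (β := 1 / (2 * s)) (by positivity)).comp
    (s, ℓ) (dα.prodMk dβ)
  refine ((dR.mul dz.exp).mul dL).congr_fderiv ?_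
  ext
  · simp [moment, Function.comp_def]; field_simp; ring
  · simp [moment, Function.comp_def]; field_simp; ring

lemma ExpGrowth.sub_affine (hg : ExpGrowth g) (a c : ℝ) :
    ExpGrowth (fun w => g w - (a + c * Real.exp w)) := by
  obtain ⟨C, q, hC, hq, hb⟩ := hg.bound
  refine ⟨by have := hg.cont; fun_prop, C + |a| + |c|, q + 1, by positivity, by positivity,
    fun w => ?_⟩
  have hE : ∀ r : ℝ, r ≤ (q + 1) * |w| → Real.exp r ≤ Real.exp ((q + 1) * |w|) :=
    fun r hr => Real.exp_le_exp.2 hr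
  have hw := abs_nonneg w
  have h1 := hE (q * |w|) (by nlinarith)
  have h2 : (1 : ℝ) ≤ Real.exp ((q + 1) * |w|) := by simpa using hE 0 (by positivity)
  have h3 := hE w ((le_abs_self w).trans (by nlinarith))
  calc |g w - (a + c * Real.exp w)| ≤ |g w| + (|a| + |c| * Real.exp w) := by
        refine (abs_sub _ _).trans (add_le_add_right ((abs_add_le _ _).trans_eq ?_) _)
        rw [abs_mul, Real.abs_exp]
    _ ≤ C * Real.exp ((q + 1) * |w|) + (|a| * Real.exp ((q + 1) * |w|) +
        |c| * Real.exp ((q + 1) * |w|)) := by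
        gcongr
        · exact (hb w).trans (by gcongr)
        · exact le_mul_of_one_le_right (abs_nonneg a) h2
    _ = _ := by ring

lemma expGrowth_const (a : ℝ) : ExpGrowth (fun _ => a) :=
  ⟨continuous_const, |a|, 0, abs_nonneg a, le_rfl, fun w => by simp⟩

lemma expGrowth_exp_mul (r : ℝ) : ExpGrowth (fun w => Real.exp (r * w)) :=
  ⟨by fun_prop, 1, |r|, zero_le_one, abs_nonneg r, fun w => by
    rw [Real.abs_exp, one_mul, ← abs_mul]; exact Real.exp_le_exp.2 (le_abs_self _)⟩

lemma expGrowth_exp : ExpGrowth Real.exp := by simpa using expGrowth_exp_mul 1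

/-- The integrands of `logMean` are locally uniformly dominated. -/
lemma ExpGrowth.exists_bound (hg : ExpGrowth g) (S R : ℝ) :
    ∃ B : ℝ → ℝ, Integrable B (gaussianReal 0 1) ∧ ∀ s ℓ ξ, 0 ≤ s → s ≤ S → |ℓ| ≤ R →
      |g (ℓ - s / 2 + √s * ξ)| ≤ B ξ := by
  obtain ⟨C, q, hC, hq, hb⟩ := hg.bound
  refine ⟨fun ξ => C * Real.exp (q * (R + S / 2)) *
    (Real.exp (q * √S * ξ) + Real.exp (-(q * √S) * ξ)),
    ((integrable_exp_mul_gaussianReal _).add (integrable_exp_mul_gaussianReal _)).const_mul _,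
    fun s ℓ ξ hs hS hℓ => (hb _).trans ?_⟩
  dsimp only
  rw [mul_assoc]
  refine mul_le_mul_of_nonneg_left ?_ hC
  have h1 : |ℓ - s / 2 + √s * ξ| ≤ R + S / 2 + √S * |ξ| := by
    refine (abs_add_le _ _).trans (add_le_add ?_ ?_)
    · refine (abs_sub _ _).trans (add_le_add hℓ ?_)
      rw [abs_of_nonneg (by positivity)]; linarith
    · rw [abs_mul, abs_of_nonneg (Real.sqrt_nonneg s)]
      exact mul_le_mul_of_nonneg_right (Real.sqrt_le_sqrt hS) (abs_nonneg ξ)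
  have h2 : q * |ℓ - s / 2 + √s * ξ| ≤ q * (R + S / 2) + |q * √S * ξ| := by
    rw [abs_mul, abs_of_nonneg (by positivity : 0 ≤ q * √S)]
    nlinarith [mul_le_mul_of_nonneg_left h1 hq]
  refine (Real.exp_le_exp.2 h2).trans ?_
  rw [Real.exp_add]
  refine mul_le_mul_of_nonneg_left ?_ (Real.exp_pos _).le
  rcases abs_cases (q * √S * ξ) with ⟨h, -⟩ | ⟨h, -⟩ <;> rw [h]
  · linarith [Real.exp_pos (-(q * √S) * ξ)]
  · rw [← neg_mul]; linarith [Real.exp_pos (q * √S * ξ)]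

lemma ExpGrowth.integrable (hg : ExpGrowth g) {s : ℝ} (hs : 0 ≤ s) (ℓ : ℝ) :
    Integrable (fun ξ => g (ℓ - s / 2 + √s * ξ)) (gaussianReal 0 1) := by
  obtain ⟨B, hB, h⟩ := hg.exists_bound s |ℓ|
  have := hg.cont
  exact hB.mono' (by fun_prop : Continuous _).aestronglyMeasurable
    (.of_forall fun ξ => h s ℓ ξ hs le_rfl le_rfl)

lemma ExpGrowth.continuousOn_logMean (hg : ExpGrowth g) :
    ContinuousOn (fun q : ℝ × ℝ => logMean g q.1 q.2) (Ici 0 ×ˢ univ) := by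
  rintro ⟨s, ℓ⟩ ⟨hs, -⟩
  obtain ⟨B, hB, h⟩ := hg.exists_bound (s + 1) (|ℓ| + 1)
  have hc := hg.cont
  have h1 : ∀ᶠ q : ℝ × ℝ in 𝓝[Ici 0 ×ˢ univ] (s, ℓ), 0 ≤ q.1 ∧ q.1 ≤ s + 1 ∧ |q.2| ≤ |ℓ| + 1 := by
    have e1 : ∀ᶠ q : ℝ × ℝ in 𝓝 (s, ℓ), q.1 < s + 1 :=
      continuous_fst.continuousAt.eventually_lt_const (by simp)
    have e2 : ∀ᶠ q : ℝ × ℝ in 𝓝 (s, ℓ), |q.2| < |ℓ| + 1 :=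
      (continuous_snd.abs).continuousAt.eventually_lt_const (by simp)
    filter_upwards [nhdsWithin_le_nhds e1, nhdsWithin_le_nhds e2, self_mem_nhdsWithin]
      with q h1 h2 h3 using ⟨h3.1, h1.le, h2.le⟩
  refine tendsto_integral_filter_of_dominated_convergence B ?_ ?_ hB ?_
  · exact .of_forall fun q => (by fun_prop : Continuous _).aestronglyMeasurable
  · filter_upwards [h1] with q hq
    exact .of_forall fun ξ => h q.1 q.2 ξ hq.1 hq.2.1 hq.2.2
  · refine .of_forall fun ξ => ?_
    have : Continuous fun q : ℝ × ℝ => g (q.2 - q.1 / 2 + √q.1 * ξ) := by fun_prop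
    exact this.continuousAt.mono_left nhdsWithin_le_nhds

lemma logMean_const (a s ℓ : ℝ) : logMean (fun _ => a) s ℓ = a := by simp [logMean]

lemma logMean_exp_mul (r : ℝ) {s : ℝ} (hs : 0 ≤ s) (ℓ : ℝ) :
    logMean (fun w => Real.exp (r * w)) s ℓ = Real.exp (r * ℓ + r * (r - 1) / 2 * s) := by
  have h := mgf_gaussianReal (p := gaussianReal 0 1) (X := id) (μ := 0) (v := 1) (by simp) (r * √s)
  rw [mgf] at h
  have e : ∀ ξ, Real.exp (r * (ℓ - s / 2 + √s * ξ)) =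
      Real.exp (r * (ℓ - s / 2)) * Real.exp (r * √s * id ξ) := fun ξ => by
    rw [← Real.exp_add]; simp only [id]; ring_nf
  simp only [logMean, e]
  rw [integral_const_mul, h, ← Real.exp_add]
  congr 1
  rw [mul_pow, Real.sq_sqrt hs]
  push_cast
  ring

lemma logMean_exp {s : ℝ} (hs : 0 ≤ s) (ℓ : ℝ) : logMean Real.exp s ℓ = Real.exp ℓ := by
  simpa using logMean_exp_mul 1 hs ℓ

/-- The difference between the second and the first derivative of `logMean g s` in `ℓ`; it is
`y² ∂²/∂y²` of the mean in the variable `y = exp ℓ`, and twice the derivative in `s`. -/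
noncomputable def curvature (g : ℝ → ℝ) (s ℓ : ℝ) : ℝ :=
  (moment g 2 s ℓ - 2 * (ℓ - s / 2) * moment g 1 s ℓ + (ℓ - s / 2) ^ 2 * moment g 0 s ℓ) / s ^ 2 -
    moment g 0 s ℓ / s - (moment g 1 s ℓ - (ℓ - s / 2) * moment g 0 s ℓ) / s

/-- The derivative of `logMean g s` in `ℓ`. -/
noncomputable def slopeMean (g : ℝ → ℝ) (s ℓ : ℝ) : ℝ :=
  (moment g 1 s ℓ - (ℓ - s / 2) * moment g 0 s ℓ) / s

lemma ExpGrowth.hasDerivAt_moment (hg : ExpGrowth g) (m : ℕ) {s : ℝ} (hs : 0 < s) (ℓ : ℝ) :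
    HasDerivAt (fun l => moment g m s l)
      ((moment g (m + 1) s ℓ - (ℓ - s / 2) * moment g m s ℓ) / s) ℓ := by
  have h := (hg.hasFDerivAt_moment m hs ℓ).comp_hasDerivAt ℓ
    ((hasDerivAt_const ℓ s).prodMk (hasDerivAt_id ℓ))
  simpa [Function.comp_def] using h

lemma ExpGrowth.hasDerivAt_logMean_space (hg : ExpGrowth g) {s : ℝ} (hs : 0 < s) (ℓ : ℝ) :
    HasDerivAt (fun l => logMean g s l) (slopeMean g s ℓ) ℓ := by
  simp only [logMean_eq_moment hg.cont hs]
  exact hg.hasDerivAt_moment 0 hs ℓ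

lemma ExpGrowth.hasDerivAt_slopeMean (hg : ExpGrowth g) {s : ℝ} (hs : 0 < s) (ℓ : ℝ) :
    HasDerivAt (fun l => slopeMean g s l) (curvature g s ℓ + slopeMean g s ℓ) ℓ := by
  have h0 := hg.hasDerivAt_moment 0 hs ℓ
  have h1 := hg.hasDerivAt_moment 1 hs ℓ
  have h := (h1.sub (((hasDerivAt_id ℓ).sub_const (s / 2)).mul h0)).div_const s
  refine h.congr_deriv ?_
  simp only [curvature, slopeMean, id]
  field_simp
  ring

/-- The heat equation for `logMean`. -/
lemma ExpGrowth.hasDerivAt_logMean_time (hg : ExpGrowth g) {s : ℝ} (hs : 0 < s) (ℓ : ℝ) :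
    HasDerivAt (fun r => logMean g r ℓ) (1 / 2 * curvature g s ℓ) s := by
  have h := (hg.hasFDerivAt_moment 0 hs ℓ).comp_hasDerivAt s
    ((hasDerivAt_id s).prodMk (hasDerivAt_const s ℓ))
  have h2 : HasDerivAt (fun r => moment g 0 r ℓ) (1 / 2 * curvature g s ℓ) s := by
    refine h.congr_deriv ?_
    simp [curvature]
    field_simp
    ring
  refine h2.congr_of_eventuallyEq ?_
  filter_upwards [lt_mem_nhds hs] with r hr using logMean_eq_moment hg.cont hr ℓ

lemma ExpGrowth.continuousOn_moment (hg : ExpGrowth g) (m : ℕ) :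
    ContinuousOn (fun q : ℝ × ℝ => moment g m q.1 q.2) (Ioi 0 ×ˢ univ) := fun q hq =>
  (hg.hasFDerivAt_moment m hq.1 q.2).continuousAt.continuousWithinAt

lemma ExpGrowth.continuousOn_slopeMean (hg : ExpGrowth g) :
    ContinuousOn (fun q : ℝ × ℝ => slopeMean g q.1 q.2) (Ioi 0 ×ˢ univ) := by
  have h0 := hg.continuousOn_moment 0
  have h1 := hg.continuousOn_moment 1
  unfold slopeMean
  exact (h1.sub ((by fun_prop : ContinuousOn (fun q : ℝ × ℝ => q.2 - q.1 / 2) _).mul h0)).div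
    continuousOn_fst fun q hq => (mem_Ioi.1 hq.1).ne'

lemma ExpGrowth.continuousOn_curvature (hg : ExpGrowth g) :
    ContinuousOn (fun q : ℝ × ℝ => curvature g q.1 q.2) (Ioi 0 ×ˢ univ) := by
  have h0 := hg.continuousOn_moment 0
  have h1 := hg.continuousOn_moment 1
  have h2 := hg.continuousOn_moment 2
  have hs : ∀ q ∈ (Ioi 0 ×ˢ univ : Set (ℝ × ℝ)), q.1 ≠ 0 := fun q hq => (mem_Ioi.1 hq.1).ne'
  have hs2 : ∀ q ∈ (Ioi 0 ×ˢ univ : Set (ℝ × ℝ)), q.1 ^ 2 ≠ 0 := fun q hq => pow_ne_zero 2 (hs q hq)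
  unfold curvature
  fun_prop (disch := assumption)

/-- The mean of a constant does not depend on `s`. -/
lemma curvature_one {s : ℝ} (hs : 0 < s) (ℓ : ℝ) : curvature (fun _ => 1) s ℓ = 0 := by
  have h := (expGrowth_const 1).hasDerivAt_logMean_time hs ℓ
  simp only [logMean_const] at h
  have := h.unique (hasDerivAt_const s (1 : ℝ))
  linarith

/-- The mean of the lognormal variable itself does not depend on `s` either. -/
lemma curvature_exp {s : ℝ} (hs : 0 < s) (ℓ : ℝ) : curvature Real.exp s ℓ = 0 := by
  have h := expGrowth_exp.hasDerivAt_logMean_time hs ℓ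
  have h2 : HasDerivAt (fun r => logMean Real.exp r ℓ) 0 s := by
    refine (hasDerivAt_const s (Real.exp ℓ)).congr_of_eventuallyEq ?_
    filter_upwards [lt_mem_nhds hs] with r hr using logMean_exp hr.le ℓ
  have := h.unique h2
  linarith

lemma ExpGrowth.moment_sub_affine (hg : ExpGrowth g) (a c : ℝ) (m : ℕ) {s : ℝ} (hs : 0 < s)
    (ℓ : ℝ) : moment (fun w => g w - (a + c * Real.exp w)) m s ℓ =
      moment g m s ℓ - (a * moment (fun _ => 1) m s ℓ + c * moment Real.exp m s ℓ) := by
  have hβ : 0 < 1 / (2 * s) := by positivity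
  have i0 := hg.integrable_laplaceKer m (ℓ / s - 1 / 2) hβ
  have i1 := ((expGrowth_const 1).integrable_laplaceKer m (ℓ / s - 1 / 2) hβ).const_mul a
  have i2 := (expGrowth_exp.integrable_laplaceKer m (ℓ / s - 1 / 2) hβ).const_mul c
  have e : laplace (fun w => g w - (a + c * Real.exp w)) m (ℓ / s - 1 / 2) (1 / (2 * s)) =
      laplace g m (ℓ / s - 1 / 2) (1 / (2 * s)) -
        (a * laplace (fun _ => 1) m (ℓ / s - 1 / 2) (1 / (2 * s)) +
          c * laplace Real.exp m (ℓ / s - 1 / 2) (1 / (2 * s))) := by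
    simp only [laplace]
    rw [← integral_const_mul, ← integral_const_mul, ← integral_add i1 i2]
    refine Eq.trans ?_ (integral_sub i0 (i1.add i2))
    congr 1
    ext w
    simp only [laplaceKer]
    ring
  simp only [moment, e]
  ring

lemma ExpGrowth.curvature_sub_affine (hg : ExpGrowth g) (a c : ℝ) {s : ℝ} (hs : 0 < s)
    (ℓ : ℝ) : curvature (fun w => g w - (a + c * Real.exp w)) s ℓ = curvature g s ℓ := by
  have h1 := curvature_one hs ℓ
  have h2 := curvature_exp hs ℓ
  have e : curvature (fun w => g w - (a + c * Real.exp w)) s ℓ =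
      curvature g s ℓ - (a * curvature (fun _ => 1) s ℓ + c * curvature Real.exp s ℓ) := by
    simp only [curvature, hg.moment_sub_affine a c _ hs]
    ring
  rw [e, h1, h2]
  ring

/-- `curvature` is the integral of `g` against a quadratic times a Gaussian. The quadratic has
two real roots, whatever `s > 0`. -/
lemma exists_curvature_eq {s : ℝ} (hs : 0 < s) (ℓ : ℝ) : ∃ w₁ w₂ κ : ℝ, w₁ < w₂ ∧ 0 < κ ∧
    ∀ {g : ℝ → ℝ}, ExpGrowth g → curvature g s ℓ =
      κ * ∫ w, (w - w₁) * (w - w₂) * laplaceKer g 0 (ℓ / s - 1 / 2) (1 / (2 * s)) w := by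
  have hd : 0 < s ^ 2 + 4 * s := by positivity
  have hr := Real.sq_sqrt hd.le
  have hr0 := Real.sqrt_pos.2 hd
  set r := √(s ^ 2 + 4 * s)
  refine ⟨ℓ - s / 2 + (s - r) / 2, ℓ - s / 2 + (s + r) / 2,
    (√(2 * Real.pi * s))⁻¹ * Real.exp (-(ℓ - s / 2) ^ 2 / (2 * s)) / s ^ 2, by linarith,
    by positivity, fun {g} hg => ?_⟩
  have hβ : 0 < 1 / (2 * s) := by positivity
  have i0 := (hg.integrable_laplaceKer 0 (ℓ / s - 1 / 2) hβ)
  have i1 := (hg.integrable_laplaceKer 1 (ℓ / s - 1 / 2) hβ)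
  have i2 := (hg.integrable_laplaceKer 2 (ℓ / s - 1 / 2) hβ)
  have e : ∫ w, (w - (ℓ - s / 2 + (s - r) / 2)) * (w - (ℓ - s / 2 + (s + r) / 2)) *
        laplaceKer g 0 (ℓ / s - 1 / 2) (1 / (2 * s)) w =
      laplace g 2 (ℓ / s - 1 / 2) (1 / (2 * s)) - 2 * ℓ * laplace g 1 (ℓ / s - 1 / 2) (1 / (2 * s)) +
        (ℓ ^ 2 - s ^ 2 / 4 - s) * laplace g 0 (ℓ / s - 1 / 2) (1 / (2 * s)) := by
    simp only [laplace]
    rw [← integral_const_mul, ← integral_const_mul, ← integral_sub i2 (i1.const_mul _)]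
    refine Eq.trans ?_ (integral_add (i2.sub (i1.const_mul _)) (i0.const_mul _))
    congr 1
    ext w
    simp only [laplaceKer]
    linear_combination (-(1 : ℝ) / 4) * Real.exp ((ℓ / s - 1 / 2) * w - 1 / (2 * s) * w ^ 2) *
      g w * hr
  rw [e]
  simp only [curvature, moment]
  field_simp
  ring

/-- **Strict convexity of the mean.** If `f` is convex but not affine on `(0,∞)`, then the mean of
`f` has positive second derivative. The kernel of the second derivative is a Gaussian times a
quadratic and integrates affine functions of `exp w` to zero, so `f` may be replaced by its
difference with the chord through the two roots, and then the integrand is nonnegative. -/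
lemma curvature_pos {f : ℝ → ℝ} (hf : ConvexOn ℝ (Ioi 0) f)
    (hg : ExpGrowth fun w => f (Real.exp w))
    (hna : ∀ a c : ℝ, ∃ w, f (Real.exp w) ≠ a + c * Real.exp w)
    {s : ℝ} (hs : 0 < s) (ℓ : ℝ) : 0 < curvature (fun w => f (Real.exp w)) s ℓ := by
  obtain ⟨w₁, w₂, κ, h12, hκ, hcurv⟩ := exists_curvature_eq hs ℓ
  have hlt : Real.exp w₁ < Real.exp w₂ := Real.exp_lt_exp.2 h12
  obtain ⟨c, hc⟩ : ∃ c, c = (f (Real.exp w₂) - f (Real.exp w₁)) / (Real.exp w₂ - Real.exp w₁) :=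
    ⟨_, rfl⟩
  obtain ⟨a, ha⟩ : ∃ a, a = f (Real.exp w₁) - c * Real.exp w₁ := ⟨_, rfl⟩
  have hc' : c * (Real.exp w₂ - Real.exp w₁) = f (Real.exp w₂) - f (Real.exp w₁) := by
    rw [hc, div_mul_cancel₀ _ (sub_pos.2 hlt).ne']
  have hG := hg.sub_affine a c
  rw [← hg.curvature_sub_affine a c hs ℓ, hcurv hG]
  refine mul_pos hκ ?_
  set G : ℝ → ℝ := fun w => f (Real.exp w) - (a + c * Real.exp w) with hGdef
  have hsign : ∀ w, 0 ≤ (w - w₁) * (w - w₂) * G w := by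
    intro w
    have mem : ∀ v, Real.exp v ∈ Ioi (0 : ℝ) := fun v => Real.exp_pos v
    rcases eq_or_ne w w₁ with rfl | h1
    · simp
    rcases eq_or_ne w w₂ with rfl | h2
    · simp
    rcases lt_or_gt_of_ne h1 with h1 | h1
    · have e1 : Real.exp w < Real.exp w₁ := Real.exp_lt_exp.2 h1
      have h := hf.slope_mono_adjacent (mem w) (mem w₂) e1 hlt
      rw [← hc, div_le_iff₀ (sub_pos.2 e1)] at h
      have hG0 : 0 ≤ G w := by simp only [hGdef]; linarith
      exact mul_nonneg (mul_nonneg_of_nonpos_of_nonpos (by linarith) (by linarith)) hG0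
    rcases lt_or_gt_of_ne h2 with h2 | h2
    · have e1 : Real.exp w₁ < Real.exp w := Real.exp_lt_exp.2 h1
      have e2 : Real.exp w < Real.exp w₂ := Real.exp_lt_exp.2 h2
      have h := hf.slope_mono_adjacent (mem w₁) (mem w₂) e1 e2
      rw [div_le_div_iff₀ (sub_pos.2 e1) (sub_pos.2 e2)] at h
      have hG1 : G w * (Real.exp w₂ - Real.exp w₁) ≤ 0 := by
        have : G w * (Real.exp w₂ - Real.exp w₁) =
            (f (Real.exp w) - f (Real.exp w₁)) * (Real.exp w₂ - Real.exp w) -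
            (f (Real.exp w₂) - f (Real.exp w)) * (Real.exp w - Real.exp w₁) := by
          simp only [hGdef, ha]
          linear_combination (Real.exp w₁ - Real.exp w) * hc'
        linarith
      have hG0 : G w ≤ 0 := nonpos_of_mul_nonpos_left hG1 (sub_pos.2 hlt)
      exact mul_nonneg_of_nonpos_of_nonpos
        (mul_nonpos_of_nonneg_of_nonpos (by linarith) (by linarith)) hG0
    · have e2 : Real.exp w₂ < Real.exp w := Real.exp_lt_exp.2 h2
      have h := hf.slope_mono_adjacent (mem w₁) (mem w) hlt e2
      rw [← hc, le_div_iff₀ (sub_pos.2 e2)] at h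
      have hG0 : 0 ≤ G w := by simp only [hGdef]; linarith
      exact mul_nonneg (mul_nonneg (by linarith) (by linarith)) hG0
  set F : ℝ → ℝ := fun w => (w - w₁) * (w - w₂) *
    laplaceKer G 0 (ℓ / s - 1 / 2) (1 / (2 * s)) w with hF
  have hβ : 0 < 1 / (2 * s) := by positivity
  have hFc : Continuous F := by
    have := hG.continuous_laplaceKer 0 (ℓ / s - 1 / 2) (1 / (2 * s))
    fun_prop
  have hFi : Integrable F := by
    have i0 := (hG.integrable_laplaceKer 0 (ℓ / s - 1 / 2) hβ).const_mul (w₁ * w₂)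
    have i1 := (hG.integrable_laplaceKer 1 (ℓ / s - 1 / 2) hβ).const_mul (-(w₁ + w₂))
    refine ((hG.integrable_laplaceKer 2 (ℓ / s - 1 / 2) hβ).add (i1.add i0)).congr
      (.of_forall fun w => ?_)
    simp only [hF, laplaceKer, Pi.add_apply]
    ring
  have hpos : 0 ≤ F := by
    intro w
    simp only [hF, laplaceKer, pow_zero, one_mul, Pi.zero_apply]
    nlinarith [mul_nonneg (hsign w)
      (Real.exp_pos ((ℓ / s - 1 / 2) * w - 1 / (2 * s) * w ^ 2)).le]
  refine (integral_nonneg hpos).lt_of_ne fun h0 => ?_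
  have hF0 : F = 0 := (hFc.ae_eq_iff_eq volume continuous_zero).1
    ((integral_eq_zero_iff_of_nonneg hpos hFi).1 h0.symm)
  obtain ⟨w, hw⟩ := hna a c
  have hGw : G w ≠ 0 := sub_ne_zero.2 hw
  have hw1 : w ≠ w₁ := by
    rintro rfl
    exact hGw (by simp only [hGdef, ha]; ring)
  have hw2 : w ≠ w₂ := by
    rintro rfl
    exact hGw (by simp only [hGdef, ha]; linear_combination -hc')
  have h1 := congrFun hF0 w
  simp [hF, laplaceKer, sub_eq_zero, hw1, hw2, hGw] at h1

end LogMean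

/-! ### Legendre inversion of a convex flow -/

section Legendre

/-- A family `v s` of functions on `(0,∞)`, `s > 0`, that are convex and nondegenerate:
`v₁ = v_y`, `v₂ = v_yy > 0`, `v₃ = v_s` exist and are jointly continuous, and `v_y` takes every
negative value. -/
structure ConvexFlow (v v₁ v₂ v₃ : ℝ → ℝ → ℝ) : Prop where
  dy : ∀ s, 0 < s → ∀ y, 0 < y → HasDerivAt (fun z => v s z) (v₁ s y) y
  dyy : ∀ s, 0 < s → ∀ y, 0 < y → HasDerivAt (fun z => v₁ s z) (v₂ s y) y
  ds : ∀ s, 0 < s → ∀ y, 0 < y → HasDerivAt (fun r => v r y) (v₃ s y) s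
  cont_y : ContinuousOn (fun q : ℝ × ℝ => v₁ q.1 q.2) (Ioi 0 ×ˢ Ioi 0)
  cont_yy : ContinuousOn (fun q : ℝ × ℝ => v₂ q.1 q.2) (Ioi 0 ×ˢ Ioi 0)
  cont_s : ContinuousOn (fun q : ℝ × ℝ => v₃ q.1 q.2) (Ioi 0 ×ˢ Ioi 0)
  pos : ∀ s, 0 < s → ∀ y, 0 < y → 0 < v₂ s y
  surj : ∀ s, 0 < s → ∀ x, 0 < x → ∃ y, 0 < y ∧ v₁ s y = -x

/-- The concave conjugate `inf_{y > 0} (v s y + x y)`. -/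
noncomputable def legendre (v : ℝ → ℝ → ℝ) (s x : ℝ) : ℝ := ⨅ y : Ioi (0 : ℝ), (v s y + x * y)

/-- The point at which `inf_{y > 0} (v s y + x y)` is attained, characterized by `v_y = -x`. -/
noncomputable def optPt (v₁ : ℝ → ℝ → ℝ) (s x : ℝ) : ℝ :=
  Classical.epsilon fun y => 0 < y ∧ v₁ s y = -x

namespace ConvexFlow

variable {v v₁ v₂ v₃ : ℝ → ℝ → ℝ} (h : ConvexFlow v v₁ v₂ v₃) {s x y : ℝ}
include h

lemma optPt_spec (hs : 0 < s) (hx : 0 < x) : 0 < optPt v₁ s x ∧ v₁ s (optPt v₁ s x) = -x :=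
  Classical.epsilon_spec (h.surj s hs x hx)

lemma strictMonoOn (hs : 0 < s) : StrictMonoOn (v₁ s) (Ioi 0) := by
  refine strictMonoOn_of_deriv_pos (convex_Ioi 0)
    (fun y hy => (h.dyy s hs y hy).continuousAt.continuousWithinAt) fun y hy => ?_
  rw [interior_Ioi] at hy
  rw [(h.dyy s hs y hy).deriv]
  exact h.pos s hs y hy

lemma optPt_le (hs : 0 < s) (hx : 0 < x) (hy : 0 < y) :
    v s (optPt v₁ s x) + x * optPt v₁ s x ≤ v s y + x * y := by
  obtain ⟨hY, hYx⟩ := h.optPt_spec hs hx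
  set Y := optPt v₁ s x
  have hd : ∀ z, 0 < z → HasDerivAt (fun z => v s z + x * z) (v₁ s z + x) z := fun z hz => by
    have h1 := (h.dy s hs z hz).add ((hasDerivAt_id z).const_mul x)
    rw [mul_one] at h1
    exact h1
  rcases le_total y Y with hle | hle
  · refine antitoneOn_of_deriv_nonpos (convex_Icc y Y)
      (fun z hz => (hd z (hy.trans_le hz.1)).continuousAt.continuousWithinAt)
      (fun z hz => ?_) (fun z hz => ?_) (left_mem_Icc.2 hle) (right_mem_Icc.2 hle) hle
    all_goals rw [interior_Icc] at hz
    · exact (hd z (hy.trans hz.1)).differentiableAt.differentiableWithinAt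
    · rw [(hd z (hy.trans hz.1)).deriv]
      have := h.strictMonoOn hs (hy.trans hz.1) hY hz.2
      linarith
  · refine monotoneOn_of_deriv_nonneg (convex_Icc Y y)
      (fun z hz => (hd z (hY.trans_le hz.1)).continuousAt.continuousWithinAt)
      (fun z hz => ?_) (fun z hz => ?_) (left_mem_Icc.2 hle) (right_mem_Icc.2 hle) hle
    all_goals rw [interior_Icc] at hz
    · exact (hd z (hY.trans hz.1)).differentiableAt.differentiableWithinAt
    · rw [(hd z (hY.trans hz.1)).deriv]
      have := h.strictMonoOn hs hY (hY.trans hz.1) hz.1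
      linarith

lemma legendre_eq (hs : 0 < s) (hx : 0 < x) :
    legendre v s x = v s (optPt v₁ s x) + x * optPt v₁ s x := by
  obtain ⟨hY, -⟩ := h.optPt_spec hs hx
  have : Nonempty (Ioi (0 : ℝ)) := ⟨⟨_, hY⟩⟩
  refine le_antisymm ?_ (le_ciInf fun y => h.optPt_le hs hx y.2)
  exact ciInf_le (f := fun y : Ioi (0 : ℝ) => v s y + x * y)
    ⟨_, by rintro _ ⟨y, rfl⟩; exact h.optPt_le hs hx y.2⟩ ⟨_, hY⟩

lemma legendre_le (hs : 0 < s) (hx : 0 < x) (hy : 0 < y) : legendre v s x ≤ v s y + x * y :=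
  (h.legendre_eq hs hx).trans_le (h.optPt_le hs hx hy)

/-- Strict monotonicity of `v_y` traps the optimal point between `Y - e` and `Y + e`. -/
lemma continuousAt_optPt (hs : 0 < s) (hx : 0 < x) :
    ContinuousAt (fun q : ℝ × ℝ => optPt v₁ q.1 q.2) (s, x) := by
  obtain ⟨hY, hYx⟩ := h.optPt_spec hs hx
  have hopen : ∀ᶠ q : ℝ × ℝ in 𝓝 (s, x), 0 < q.1 ∧ 0 < q.2 :=
    (isOpen_Ioi.prod isOpen_Ioi).mem_nhds (⟨hs, hx⟩ : (s, x) ∈ Ioi (0 : ℝ) ×ˢ Ioi (0 : ℝ))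
  have hc : ∀ z, 0 < z → ContinuousAt (fun q : ℝ × ℝ => v₁ q.1 z + q.2) (s, x) := by
    intro z hz
    have h1 : ContinuousAt (fun q : ℝ × ℝ => v₁ q.1 q.2) (s, z) :=
      h.cont_y.continuousAt ((isOpen_Ioi.prod isOpen_Ioi).mem_nhds ⟨hs, hz⟩)
    exact (h1.comp (x := (s, x)) (f := fun q : ℝ × ℝ => (q.1, z)) (by fun_prop)).add
      continuousAt_snd
  refine Metric.continuousAt_iff'.2 fun ε hε => ?_
  set Y := optPt v₁ s x
  obtain ⟨e, he⟩ : ∃ e, e = min ε Y / 2 := ⟨_, rfl⟩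
  have he0 : 0 < e := he ▸ half_pos (lt_min hε hY)
  have heε : e < ε := by have := min_le_left ε Y; linarith
  have heY : e < Y := by have := min_le_right ε Y; linarith
  have hlo : v₁ s (Y - e) + x < 0 := by
    have := h.strictMonoOn hs (mem_Ioi.2 (sub_pos.2 heY)) hY (by linarith : Y - e < Y)
    linarith
  have hhi : 0 < v₁ s (Y + e) + x := by
    have := h.strictMonoOn hs hY (mem_Ioi.2 (by linarith : 0 < Y + e)) (by linarith : Y < Y + e)
    linarith
  filter_upwards [hopen, (hc (Y - e) (sub_pos.2 heY)).eventually_lt_const hlo,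
    (hc (Y + e) (by linarith)).eventually_const_lt hhi] with q hq h1 h2
  obtain ⟨hY', hYx'⟩ := h.optPt_spec hq.1 hq.2
  have g1 : Y - e < optPt v₁ q.1 q.2 :=
    ((h.strictMonoOn hq.1).lt_iff_lt (mem_Ioi.2 (sub_pos.2 heY)) hY').1 (by linarith)
  have g2 : optPt v₁ q.1 q.2 < Y + e :=
    ((h.strictMonoOn hq.1).lt_iff_lt hY' (mem_Ioi.2 (by linarith : 0 < Y + e))).1 (by linarith)
  rw [Real.dist_eq, abs_lt]
  constructor <;> linarith

lemma hasDerivAt_optPt (hs : 0 < s) (hx : 0 < x) :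
    HasDerivAt (fun z => optPt v₁ s z) (-(v₂ s (optPt v₁ s x))⁻¹) x := by
  obtain ⟨hY, -⟩ := h.optPt_spec hs hx
  have hc : ContinuousAt (fun z => optPt v₁ s z) x :=
    (h.continuousAt_optPt hs hx).comp (f := fun z => (s, z)) (by fun_prop)
  have hd := (h.dyy s hs _ hY).neg
  rw [← inv_neg]
  refine hd.of_local_left_inverse hc (neg_ne_zero.2 (h.pos s hs _ hY).ne') ?_
  filter_upwards [lt_mem_nhds hx] with z hz
  simp [(h.optPt_spec hs hz).2]

/-- The envelope theorem in `x`: the increment of the infimum lies between the increments of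
`x y` at the two optimal points. -/
lemma hasDerivAt_legendre_space (hs : 0 < s) (hx : 0 < x) :
    HasDerivAt (fun z => legendre v s z) (optPt v₁ s x) x := by
  have hc : ContinuousAt (fun z => optPt v₁ s z) x :=
    (h.continuousAt_optPt hs hx).comp (f := fun z => (s, z)) (by fun_prop)
  rw [hasDerivAt_iff_isLittleO, Asymptotics.isLittleO_iff]
  intro c hc0
  filter_upwards [lt_mem_nhds hx, Metric.continuousAt_iff'.1 hc c hc0] with z hz hd
  obtain ⟨hY, -⟩ := h.optPt_spec hs hx
  obtain ⟨hY', -⟩ := h.optPt_spec hs hz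
  have e1 := h.legendre_eq hs hx
  have e2 := h.legendre_eq hs hz
  have l1 := h.legendre_le hs hx hY'
  have l2 := h.legendre_le hs hz hY
  set Y := optPt v₁ s x
  set Y' := optPt v₁ s z
  rw [Real.dist_eq] at hd
  have hb : |legendre v s z - legendre v s x - (z - x) * Y| ≤ |(z - x) * (Y' - Y)| := by
    rw [abs_le]
    constructor
    · have := neg_abs_le ((z - x) * (Y' - Y))
      nlinarith
    · have := abs_nonneg ((z - x) * (Y' - Y))
      nlinarith
  rw [abs_mul] at hb
  simp only [Real.norm_eq_abs, smul_eq_mul]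
  nlinarith [abs_nonneg (z - x)]

/-- The envelope theorem in `s`. -/
lemma hasDerivAt_legendre_time (hs : 0 < s) (hx : 0 < x) :
    HasDerivAt (fun r => legendre v r x) (v₃ s (optPt v₁ s x)) s := by
  have hc : ContinuousAt (fun r => optPt v₁ r x) s :=
    (h.continuousAt_optPt hs hx).comp (f := fun r => (r, x)) (by fun_prop)
  rw [hasDerivAt_iff_isLittleO, Asymptotics.isLittleO_iff]
  intro c hc0
  obtain ⟨hY, -⟩ := h.optPt_spec hs hx
  set Y := optPt v₁ s x with hYdef
  have hcs : ContinuousAt (fun q : ℝ × ℝ => v₃ q.1 q.2) (s, Y) :=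
    h.cont_s.continuousAt ((isOpen_Ioi.prod isOpen_Ioi).mem_nhds ⟨hs, hY⟩)
  have hev : ∀ᶠ q : ℝ × ℝ in 𝓝 (s, Y), (0 < q.1 ∧ 0 < q.2) ∧ |v₃ q.1 q.2 - v₃ s Y| < c := by
    have h1 := Metric.continuousAt_iff'.1 hcs c hc0
    simp only [Real.dist_eq] at h1
    have h2 : ∀ᶠ q : ℝ × ℝ in 𝓝 (s, Y), 0 < q.1 ∧ 0 < q.2 :=
      (isOpen_Ioi.prod isOpen_Ioi).mem_nhds (⟨hs, hY⟩ : (s, Y) ∈ Ioi (0 : ℝ) ×ˢ Ioi (0 : ℝ))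
    exact h2.and h1
  obtain ⟨δ, hδ, hball⟩ := Metric.eventually_nhds_iff.1 hev
  -- uniformly in `y` near `Y`, the increment of `v` in `s` is linear up to `c |r - s|`
  have key : ∀ r y, |r - s| < δ → |y - Y| < δ →
      |v r y - v s y - (r - s) * v₃ s Y| ≤ c * |r - s| := by
    intro r y hr hy
    have hin : ∀ r', |r' - s| < δ → (0 < r' ∧ 0 < y) ∧ |v₃ r' y - v₃ s Y| < c := fun r' hr' =>
      hball (y := (r', y)) (by simpa [Prod.dist_eq, Real.dist_eq] using ⟨hr', hy⟩)
    have hd : ∀ r' ∈ Metric.ball s δ, HasDerivWithinAt (fun r' => v r' y - r' * v₃ s Y)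
        (v₃ r' y - v₃ s Y) (Metric.ball s δ) r' := by
      intro r' hr'
      have h1 := hin r' (by simpa [Real.dist_eq] using hr')
      have h2 := (h.ds r' h1.1.1 y h1.1.2).sub ((hasDerivAt_id r').mul_const (v₃ s Y))
      rw [one_mul] at h2
      exact h2.hasDerivWithinAt
    have h3 := (convex_ball s δ).norm_image_sub_le_of_norm_hasDerivWithin_le hd
      (fun r' hr' => (hin r' (by simpa [Real.dist_eq] using hr')).2.le)
      (Metric.mem_ball_self hδ) (by simpa [Real.dist_eq] using hr : r ∈ Metric.ball s δ)
    simp only [Real.norm_eq_abs] at h3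
    convert h3 using 2
    ring
  filter_upwards [lt_mem_nhds hs, Metric.ball_mem_nhds s hδ,
    Metric.continuousAt_iff'.1 hc δ hδ] with r hr hrδ hd
  rw [Metric.mem_ball, Real.dist_eq] at hrδ
  rw [Real.dist_eq] at hd
  obtain ⟨hY', -⟩ := h.optPt_spec hr hx
  have e1 := h.legendre_eq hs hx
  have e2 := h.legendre_eq hr hx
  have l1 := h.legendre_le hs hx hY'
  have l2 := h.legendre_le hr hx hY
  have k1 := abs_le.1 (key r Y hrδ (by simpa using hδ))
  have k2 := abs_le.1 (key r _ hrδ hd)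
  simp only [Real.norm_eq_abs, smul_eq_mul]
  rw [abs_le]
  constructor <;> linarith [k1.1, k1.2, k2.1, k2.2]

end ConvexFlow

end Legendre

/-! ### The dual value function -/

section Dual

open ProbabilityTheory MeasureTheory

/-- The properties of the conjugate of a utility function used to build the dual value function.
The field `minorant` gives affine minorants with arbitrarily large intercepts, as for the conjugate
of an unbounded utility. -/
structure IsDualUtility (f : ℝ → ℝ) : Prop where
  convex : ConvexOn ℝ (Ioi 0) f
  nonneg : ∀ y, 0 < y → 0 ≤ f y
  growth : ∃ C q : ℝ, 0 ≤ C ∧ 0 ≤ q ∧ ∀ y, 0 < y → f y ≤ C * (1 + y ^ (-q))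
  minorant : ∀ B, ∃ x, ∀ y, 0 < y → B - x * y ≤ f y

/-- The dual value function `E[f (y Z)]`, where `log Z` is normal with mean `- s / 2` and
variance `s`. -/
noncomputable def dualVal (f : ℝ → ℝ) (s y : ℝ) : ℝ :=
  logMean (fun w => f (Real.exp w)) s (Real.log y)

lemma continuousOn_comp_log {F : ℝ → ℝ → ℝ}
    (hF : ContinuousOn (fun q : ℝ × ℝ => F q.1 q.2) (Ioi 0 ×ˢ univ)) :
    ContinuousOn (fun q : ℝ × ℝ => F q.1 (Real.log q.2)) (Ioi 0 ×ˢ Ioi 0) :=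
  hF.comp (f := fun q : ℝ × ℝ => (q.1, Real.log q.2))
    (continuousOn_fst.prodMk (continuousOn_snd.log fun _ hq => (mem_Ioi.1 hq.2).ne'))
    fun _ hq => ⟨hq.1, mem_univ _⟩

lemma dualVal_zero (f : ℝ → ℝ) {y : ℝ} (hy : 0 < y) : dualVal f 0 y = f y := by
  rw [dualVal, logMean_zero, Real.exp_log hy]

namespace IsDualUtility

variable {f : ℝ → ℝ} (hf : IsDualUtility f) {s y : ℝ}
include hf

lemma expGrowth : ExpGrowth fun w => f (Real.exp w) := by
  obtain ⟨C, q, hC, hq, hb⟩ := hf.growth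
  refine ⟨?_, 2 * C, q, by positivity, hq, fun w => ?_⟩
  · exact (hf.convex.continuousOn isOpen_Ioi).comp_continuous Real.continuous_exp Real.exp_pos
  · rw [abs_of_nonneg (hf.nonneg _ (Real.exp_pos w))]
    refine (hb _ (Real.exp_pos w)).trans ?_
    rw [← Real.exp_mul, two_mul, add_mul, mul_add, mul_one]
    refine add_le_add (le_mul_of_one_le_right hC (Real.one_le_exp (by positivity))) ?_
    refine mul_le_mul_of_nonneg_left (Real.exp_le_exp.2 ?_) hC
    nlinarith [neg_abs_le w]

lemma dualVal_le {a c q : ℝ} (h : ∀ y, 0 < y → f y ≤ a + c * y ^ (-q)) (hs : 0 ≤ s)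
    (hy : 0 < y) : dualVal f s y ≤ a + c * (y ^ (-q) * Real.exp (q * (q + 1) / 2 * s)) := by
  have i1 := ((expGrowth_exp_mul (-q)).integrable hs (Real.log y)).const_mul c
  have h1 : dualVal f s y ≤ ∫ ξ, (a + c * Real.exp (-q * (Real.log y - s / 2 + √s * ξ)))
      ∂gaussianReal 0 1 := by
    refine integral_mono (hf.expGrowth.integrable hs _) ((integrable_const a).add i1) fun ξ => ?_
    refine (h _ (Real.exp_pos _)).trans_eq ?_
    rw [← Real.exp_mul, mul_comm (-q)]
  refine h1.trans_eq ?_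
  rw [integral_add (integrable_const a) i1, integral_const_mul]
  have h2 := logMean_exp_mul (-q) hs (Real.log y)
  rw [logMean] at h2
  rw [h2, Real.exp_add, Real.rpow_def_of_pos hy]
  simp only [integral_const, probReal_univ, one_smul]
  ring_nf

/-- Affine minorants are preserved, because `Z` has mean one. -/
lemma le_dualVal {a x : ℝ} (h : ∀ y, 0 < y → a - x * y ≤ f y) (hs : 0 ≤ s) (hy : 0 < y) :
    a - x * y ≤ dualVal f s y := by
  have i1 := (expGrowth_exp.integrable hs (Real.log y)).const_mul x
  have h1 : ∫ ξ, (a - x * Real.exp (Real.log y - s / 2 + √s * ξ)) ∂gaussianReal 0 1 ≤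
      dualVal f s y :=
    integral_mono ((integrable_const a).sub i1) (hf.expGrowth.integrable hs _)
      fun ξ => h _ (Real.exp_pos _)
  refine le_of_eq_of_le ?_ h1
  rw [integral_sub (integrable_const a) i1, integral_const_mul]
  have h2 := logMean_exp hs (Real.log y)
  rw [logMean] at h2
  rw [h2, Real.exp_log hy]
  simp

lemma dualVal_nonneg (hs : 0 ≤ s) (hy : 0 < y) : 0 ≤ dualVal f s y := by
  simpa using hf.le_dualVal (a := 0) (x := 0) (by simpa using hf.nonneg) hs hy

/-- The dual value function is unbounded near `y = 0`, uniformly in `s`. -/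
lemma exists_lt_dualVal (B : ℝ) : ∃ y, 0 < y ∧ y ≤ 1 ∧ ∀ s, 0 ≤ s → B < dualVal f s y := by
  obtain ⟨x, hx⟩ := hf.minorant (B + 2)
  have hp : 0 < |x| + 1 := by positivity
  refine ⟨1 / (|x| + 1), by positivity, (div_le_one hp).2 (by linarith [abs_nonneg x]),
    fun s hs => ?_⟩
  have h1 := hf.le_dualVal hx hs (one_div_pos.2 hp)
  have h2 : x * (1 / (|x| + 1)) ≤ 1 := by
    rw [mul_one_div, div_le_one hp]
    linarith [le_abs_self x]
  linarith

lemma not_affine (a c : ℝ) : ∃ w, f (Real.exp w) ≠ a + c * Real.exp w := by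
  obtain ⟨y, hy, hy1, h⟩ := hf.exists_lt_dualVal (|a| + |c|)
  have h0 := h 0 le_rfl
  rw [dualVal_zero f hy] at h0
  refine ⟨Real.log y, fun he => ?_⟩
  rw [Real.exp_log hy] at he
  nlinarith [le_abs_self a, le_abs_self c, abs_nonneg c]

lemma continuousOn_dualVal :
    ContinuousOn (fun q : ℝ × ℝ => dualVal f q.1 q.2) (Ici 0 ×ˢ Ioi 0) := by
  refine hf.expGrowth.continuousOn_logMean.comp
    (f := fun q : ℝ × ℝ => (q.1, Real.log q.2)) ?_ fun q hq => ⟨hq.1, mem_univ _⟩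
  exact continuousOn_fst.prodMk (continuousOn_snd.log fun q hq => (mem_Ioi.1 hq.2).ne')

lemma hasDerivAt_dualVal (hs : 0 < s) (hy : 0 < y) : HasDerivAt (fun z => dualVal f s z)
    (slopeMean (fun w => f (Real.exp w)) s (Real.log y) / y) y := by
  have h := (hf.expGrowth.hasDerivAt_logMean_space hs (Real.log y)).comp y
    (Real.hasDerivAt_log hy.ne')
  rwa [← div_eq_mul_inv] at h

/-- The slope of the dual value function takes every negative value. -/
lemma exists_slope_eq (hs : 0 < s) {x : ℝ} (hx : 0 < x) :
    ∃ y, 0 < y ∧ slopeMean (fun w => f (Real.exp w)) s (Real.log y) / y = -x := by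
  set φ : ℝ → ℝ := fun y => slopeMean (fun w => f (Real.exp w)) s (Real.log y) / y with hφ
  have hd : ∀ z, 0 < z → HasDerivAt (fun z => dualVal f s z + x * z) (φ z + x) z := fun z hz => by
    have h1 := (hf.hasDerivAt_dualVal hs hz).add ((hasDerivAt_id z).const_mul x)
    rw [mul_one] at h1
    exact h1
  have hφc : ContinuousOn φ (Ioi 0) := by
    refine ContinuousOn.div ?_ continuousOn_id fun y hy => (mem_Ioi.1 hy).ne'
    exact fun y hy => ((hf.expGrowth.hasDerivAt_slopeMean hs _).continuousAt.comp
      (Real.continuousAt_log (mem_Ioi.1 hy).ne')).continuousWithinAt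
  -- the slope exceeds `-x` somewhere, since `v ≥ 0`
  obtain ⟨y₁, hy₁, h1⟩ : ∃ y, 0 < y ∧ -x ≤ φ y := by
    by_contra! hcon
    have hanti : AntitoneOn (fun z => dualVal f s z + x * z) (Ioi 0) := by
      refine antitoneOn_of_deriv_nonpos (convex_Ioi 0)
        (fun z hz => (hd z hz).continuousAt.continuousWithinAt) (fun z hz => ?_) fun z hz => ?_
      all_goals rw [interior_Ioi] at hz
      · exact (hd z hz).differentiableAt.differentiableWithinAt
      · rw [(hd z hz).deriv]
        linarith [hcon z hz]
    have hv1 := hf.dualVal_nonneg hs.le one_pos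
    have hz : (1 : ℝ) ≤ dualVal f s 1 / x + 2 := by have := div_nonneg hv1 hx.le; linarith
    have h2 := hanti (mem_Ioi.2 one_pos) (mem_Ioi.2 (one_pos.trans_le hz)) hz
    have h3 := hf.dualVal_nonneg hs.le (one_pos.trans_le hz)
    have h4 : x * (dualVal f s 1 / x + 2) = dualVal f s 1 + 2 * x := by field_simp
    simp only at h2
    linarith
  -- the slope is below `-x` somewhere, since `v` is unbounded near `0`
  obtain ⟨y₂, hy₂, h2⟩ : ∃ y, 0 < y ∧ φ y ≤ -x := by
    by_contra! hcon
    have hmono : MonotoneOn (fun z => dualVal f s z + x * z) (Ioi 0) := by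
      refine monotoneOn_of_deriv_nonneg (convex_Ioi 0)
        (fun z hz => (hd z hz).continuousAt.continuousWithinAt) (fun z hz => ?_) fun z hz => ?_
      all_goals rw [interior_Ioi] at hz
      · exact (hd z hz).differentiableAt.differentiableWithinAt
      · rw [(hd z hz).deriv]
        linarith [hcon z hz]
    obtain ⟨y, hy, hy1, h⟩ := hf.exists_lt_dualVal (dualVal f s 1 + x)
    have h2 := hmono (mem_Ioi.2 hy) (mem_Ioi.2 one_pos) hy1
    have h3 := h s hs.le
    simp only at h2
    nlinarith
  obtain ⟨y, hy, hyx⟩ := isPreconnected_Ioi.intermediate_value hy₂ hy₁ hφc ⟨h2, h1⟩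
  exact ⟨y, hy, hyx⟩

lemma hasDerivAt_dualVal_slope (hs : 0 < s) (hy : 0 < y) :
    HasDerivAt (fun z => slopeMean (fun w => f (Real.exp w)) s (Real.log z) / z)
      (curvature (fun w => f (Real.exp w)) s (Real.log y) / y ^ 2) y := by
  have h := ((hf.expGrowth.hasDerivAt_slopeMean hs (Real.log y)).comp y
    (Real.hasDerivAt_log hy.ne')).div (hasDerivAt_id y) hy.ne'
  refine h.congr_deriv ?_
  simp only [Function.comp, id]
  field_simp
  ring

lemma convexFlow : ConvexFlow (dualVal f)
    (fun s y => slopeMean (fun w => f (Real.exp w)) s (Real.log y) / y)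
    (fun s y => curvature (fun w => f (Real.exp w)) s (Real.log y) / y ^ 2)
    (fun s y => 1 / 2 * curvature (fun w => f (Real.exp w)) s (Real.log y)) := by
  have hcurv := continuousOn_comp_log hf.expGrowth.continuousOn_curvature
  have hslope := continuousOn_comp_log hf.expGrowth.continuousOn_slopeMean
  exact {
    dy := fun s hs y hy => hf.hasDerivAt_dualVal hs hy
    dyy := fun s hs y hy => hf.hasDerivAt_dualVal_slope hs hy
    ds := fun s hs y _ => hf.expGrowth.hasDerivAt_logMean_time hs _
    cont_y := hslope.div continuousOn_snd fun q hq => (mem_Ioi.1 hq.2).ne'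
    cont_yy := hcurv.div (continuousOn_snd.pow 2) fun q hq => pow_ne_zero 2 (mem_Ioi.1 hq.2).ne'
    cont_s := continuousOn_const.mul hcurv
    pos := fun s hs y hy =>
      div_pos (curvature_pos hf.convex hf.expGrowth hf.not_affine hs _) (pow_pos hy 2)
    surj := fun s hs x hx => hf.exists_slope_eq hs hx }

end IsDualUtility

lemma isDualUtility_conj {L p : ℝ} {U : ℝ → ℝ} (hL : 0 < L) (hp0 : 0 < p) (hp1 : p < 1)
    (hU : IsUtility L p U) : IsDualUtility (conj U) := by
  refine ⟨convexOn_conj hL hp0 hp1 hU, fun y hy => conj_nonneg hL hp0 hp1 hU hy,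
    ⟨max L (L * L ^ (p / (1 - p))), p / (1 - p), by positivity,
      div_nonneg hp0.le (by linarith), fun y hy => conj_le fun x hx => ?_⟩, fun B => ?_⟩
  · have h := utility_sub_le hL hp0 hp1 hU hx hy
    have hy' : 0 ≤ y ^ (-(p / (1 - p))) := by positivity
    nlinarith [le_max_left L (L * L ^ (p / (1 - p))),
      mul_le_mul_of_nonneg_right (le_max_right L (L * L ^ (p / (1 - p)))) hy']
  · obtain ⟨x, hx1, hx2⟩ :=
      ((hU.tendsto_top.eventually_ge_atTop B).and (eventually_ge_atTop 0)).exists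
    exact ⟨x, fun y hy => by linarith [sub_le_conj hL hp0 hp1 hU hx2 hy]⟩

end Dual

/-! ### The primal value function -/

section Primal

/-- The value function as a function of the remaining variance `s` and the wealth `x`. -/
noncomputable def primalVal (U : ℝ → ℝ) : ℝ → ℝ → ℝ := legendre (dualVal (conj U))

variable {L p : ℝ} {U : ℝ → ℝ} (hL : 0 < L) (hp0 : 0 < p) (hp1 : p < 1) (hU : IsUtility L p U)
  {s x y : ℝ}
include hL hp0 hp1 hU

lemma utility_le_dualVal_add (hs : 0 ≤ s) (hx : 0 ≤ x) (hy : 0 < y) :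
    U x ≤ dualVal (conj U) s y + x * y := by
  have := (isDualUtility_conj hL hp0 hp1 hU).le_dualVal
    (fun y hy => sub_le_conj hL hp0 hp1 hU hx hy) hs hy
  linarith

lemma utility_le_primalVal (hs : 0 ≤ s) (hx : 0 ≤ x) : U x ≤ primalVal U s x :=
  have : Nonempty (Ioi (0 : ℝ)) := ⟨⟨1, mem_Ioi.2 one_pos⟩⟩
  le_ciInf fun y => utility_le_dualVal_add hL hp0 hp1 hU hs hx y.2

lemma primalVal_le (hs : 0 ≤ s) (hx : 0 ≤ x) (hy : 0 < y) :
    primalVal U s x ≤ dualVal (conj U) s y + x * y :=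
  ciInf_le (f := fun y : Ioi (0 : ℝ) => dualVal (conj U) s y + x * y)
    ⟨U x, by rintro _ ⟨y, rfl⟩; exact utility_le_dualVal_add hL hp0 hp1 hU hs hx y.2⟩ ⟨y, hy⟩

/-- The dual value function vanishes at infinity. -/
lemma exists_dualVal_le (hs : 0 ≤ s) {ε : ℝ} (hε : 0 < ε) :
    ∃ y, 0 < y ∧ dualVal (conj U) s y ≤ ε := by
  have hf := isDualUtility_conj hL hp0 hp1 hU
  obtain ⟨y₀, hy₀, h₀⟩ := exists_conj_le hU (half_pos hε)
  have hq : 0 < p / (1 - p) := div_pos hp0 (by linarith)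
  set q := p / (1 - p) with hqdef
  -- below `y₀` the constant `L` is dominated by a multiple of the power
  have hb : ∀ y, 0 < y → conj U y ≤ ε / 2 + (L * y₀ ^ q + L * L ^ q) * y ^ (-q) := by
    intro y hy
    have hyq : 0 ≤ y ^ (-q) := by positivity
    rcases le_total y₀ y with h | h
    · have : 0 ≤ (L * y₀ ^ q + L * L ^ q) * y ^ (-q) := by positivity
      linarith [h₀ y h]
    · have h1 : conj U y ≤ L + L * L ^ q * y ^ (-q) :=
        conj_le fun x hx => utility_sub_le hL hp0 hp1 hU hx hy
      have h2 : 1 ≤ y₀ ^ q * y ^ (-q) := by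
        rw [Real.rpow_neg hy.le, ← div_eq_mul_inv, one_le_div (by positivity)]
        exact Real.rpow_le_rpow hy.le h hq.le
      nlinarith
  have hlim : Tendsto (fun y : ℝ => ε / 2 + (L * y₀ ^ q + L * L ^ q) *
      (y ^ (-q) * Real.exp (q * (q + 1) / 2 * s))) atTop (𝓝 (ε / 2)) := by
    have := (((tendsto_rpow_neg_atTop hq).mul_const (Real.exp (q * (q + 1) / 2 * s))).const_mul
      (L * y₀ ^ q + L * L ^ q)).const_add (ε / 2)
    simpa using this
  obtain ⟨y, hy, hy0⟩ :=
    ((hlim.eventually_le_const (half_lt_self hε)).and (eventually_gt_atTop 0)).exists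
  exact ⟨y, hy0, (hf.dualVal_le hb hs hy0).trans hy⟩

lemma primalVal_zero_right (hs : 0 ≤ s) : primalVal U s 0 = 0 := by
  refine le_antisymm (le_of_forall_pos_le_add fun ε hε => ?_) ?_
  · obtain ⟨y, hy, h⟩ := exists_dualVal_le hL hp0 hp1 hU hs hε
    have := primalVal_le hL hp0 hp1 hU hs le_rfl hy
    linarith
  · simpa [hU.zero] using utility_le_primalVal hL hp0 hp1 hU hs le_rfl

/-- At zero variance the value is the biconjugate of the utility. -/
lemma primalVal_zero_left (hx : 0 ≤ x) : primalVal U 0 x = U x := by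
  rcases hx.eq_or_lt with rfl | hx0
  · rw [primalVal_zero_right hL hp0 hp1 hU le_rfl, hU.zero]
  refine le_antisymm ?_ (utility_le_primalVal hL hp0 hp1 hU le_rfl hx)
  obtain ⟨y, hy, h⟩ := exists_conj_add_le hU hx0
  have := primalVal_le hL hp0 hp1 hU le_rfl hx hy
  rw [dualVal_zero _ hy] at this
  exact this.trans h

/-- The growth bound is the dual bound `v ≤ L + c y ^ (-q)`, `q = p / (1 - p)`, at a suitable `y`. -/
lemma primalVal_growth (S : ℝ) : ∃ C : ℝ, ∀ s, 0 ≤ s → s ≤ S → ∀ x, 0 ≤ x →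
    primalVal U s x ≤ C * (1 + x ^ p) := by
  have hf := isDualUtility_conj hL hp0 hp1 hU
  have hp : 0 < 1 - p := by linarith
  have hq : 0 < p / (1 - p) := div_pos hp0 hp
  have hqe : (p - 1) * -(p / (1 - p)) = p := by field_simp; ring
  set q := p / (1 - p) with hqdef
  refine ⟨L + L * L ^ q * Real.exp (q * (q + 1) / 2 * S) + 1, fun s hs hsS x hx => ?_⟩
  have hx1 : 0 < 1 + x := by linarith
  -- the choice of `y` that balances `y ^ (-q)` against `x y`
  have hy : 0 < (1 + x) ^ (p - 1) := Real.rpow_pos_of_pos hx1 _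
  have h1 := primalVal_le hL hp0 hp1 hU hs hx hy
  have h2 := hf.dualVal_le (a := L) (c := L * L ^ q) (q := q)
    (fun y hy => conj_le fun x hx => utility_sub_le hL hp0 hp1 hU hx hy) hs hy
  rw [← Real.rpow_mul hx1.le, hqe] at h2
  have h3 : x * (1 + x) ^ (p - 1) ≤ (1 + x) ^ p := by
    calc x * (1 + x) ^ (p - 1) ≤ (1 + x) * (1 + x) ^ (p - 1) :=
          mul_le_mul_of_nonneg_right (by linarith) hy.le
      _ = (1 + x) ^ p := by rw [mul_comm, ← Real.rpow_add_one hx1.ne']; congr 1; ring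
  have h4 : (1 + x) ^ p ≤ 1 + x ^ p := by
    simpa using Real.rpow_add_le_add_rpow zero_le_one hx hp0.le hp1.le
  have h5 : Real.exp (q * (q + 1) / 2 * s) ≤ Real.exp (q * (q + 1) / 2 * S) := by gcongr
  have h6 : 0 ≤ x ^ p := by positivity
  have h7 : L * L ^ q * ((1 + x) ^ p * Real.exp (q * (q + 1) / 2 * s)) ≤
      L * L ^ q * ((1 + x ^ p) * Real.exp (q * (q + 1) / 2 * S)) := by gcongr
  nlinarith

/-- The dual value function is a convex flow that solves `v_s = ½ y² v_yy`. -/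
lemma exists_convexFlow_conj : ∃ v₁ v₂ v₃ : ℝ → ℝ → ℝ, ConvexFlow (dualVal (conj U)) v₁ v₂ v₃ ∧
    ∀ s, 0 < s → ∀ y, 0 < y → v₃ s y = 1 / 2 * (y ^ 2 * v₂ s y) :=
  ⟨_, _, _, (isDualUtility_conj hL hp0 hp1 hU).convexFlow, fun s _ y hy => by field_simp⟩

/-- Continuity up to the boundary: the value is an infimum of continuous functions, and on the
boundary it coincides with the continuous minorant `U`. -/
lemma continuousOn_primalVal :
    ContinuousOn (fun q : ℝ × ℝ => primalVal U q.1 q.2) (Ici 0 ×ˢ Ici 0) := by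
  have hf := isDualUtility_conj hL hp0 hp1 hU
  obtain ⟨v₁, v₂, v₃, hflow, -⟩ := exists_convexFlow_conj hL hp0 hp1 hU
  have hboundary : ∀ s x : ℝ, 0 ≤ s → 0 ≤ x → s = 0 ∨ x = 0 → primalVal U s x = U x := by
    rintro s x hs hx (rfl | rfl)
    · exact primalVal_zero_left hL hp0 hp1 hU hx
    · rw [primalVal_zero_right hL hp0 hp1 hU hs, hU.zero]
  rintro ⟨s, x⟩ ⟨hs, hx⟩
  simp only [mem_Ici] at hs hx
  refine tendsto_order.2 ⟨fun c hc => ?_, fun c hc => ?_⟩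
  · by_cases hb : s = 0 ∨ x = 0
    · simp only [hboundary s x hs hx hb] at hc
      have hUc : ContinuousWithinAt (fun q : ℝ × ℝ => U q.2) (Ici 0 ×ˢ Ici 0) (s, x) :=
        (hU.cont x hx).comp (f := fun q : ℝ × ℝ => q.2) (x := (s, x))
          continuousWithinAt_snd fun q hq => hq.2
      filter_upwards [hUc.eventually_const_lt hc, self_mem_nhdsWithin] with q h1 h2
      exact h1.trans_le (utility_le_primalVal hL hp0 hp1 hU h2.1 h2.2)
    · push Not at hb
      have hs0 : 0 < s := hs.lt_of_ne hb.1.symm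
      have hx0 : 0 < x := hx.lt_of_ne hb.2.symm
      obtain ⟨hY, -⟩ := hflow.optPt_spec hs0 hx0
      have hYc := hflow.continuousAt_optPt hs0 hx0
      have hv : ContinuousAt (fun q : ℝ × ℝ => dualVal (conj U) q.1 q.2) (s, optPt v₁ s x) :=
        hf.continuousOn_dualVal.continuousAt (prod_mem_nhds (Ici_mem_nhds hs0) (Ioi_mem_nhds hY))
      have hc2 := (hv.comp (x := (s, x)) (f := fun q : ℝ × ℝ => (q.1, optPt v₁ q.1 q.2))
        (continuousAt_fst.prodMk hYc)).add (continuousAt_snd.mul hYc)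
      have hev : ∀ᶠ q : ℝ × ℝ in 𝓝 (s, x), 0 < q.1 ∧ 0 < q.2 :=
        prod_mem_nhds (Ioi_mem_nhds hs0) (Ioi_mem_nhds hx0)
      have hc3 : c < dualVal (conj U) s (optPt v₁ s x) + x * optPt v₁ s x := by
        rw [← hflow.legendre_eq hs0 hx0]
        exact hc
      filter_upwards [nhdsWithin_le_nhds (hc2.eventually_const_lt hc3), nhdsWithin_le_nhds hev]
        with q h1 h2
      rw [primalVal, hflow.legendre_eq h2.1 h2.2]
      exact h1
  · obtain ⟨⟨y, hy⟩, hyc⟩ : ∃ y : Ioi (0 : ℝ), dualVal (conj U) s y + x * y < c :=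
      have : Nonempty (Ioi (0 : ℝ)) := ⟨⟨1, mem_Ioi.2 one_pos⟩⟩
      exists_lt_of_ciInf_lt hc
    have hv : ContinuousWithinAt (fun q : ℝ × ℝ => dualVal (conj U) q.1 y + q.2 * y)
        (Ici 0 ×ˢ Ici 0) (s, x) := by
      refine ((hf.continuousOn_dualVal (s, y) ⟨hs, hy⟩).comp (x := (s, x))
        (f := fun q : ℝ × ℝ => (q.1, y)) ?_ fun q hq => ⟨hq.1, hy⟩).add ?_
      · exact (by fun_prop : Continuous fun q : ℝ × ℝ => (q.1, y)).continuousWithinAt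
      · exact (by fun_prop : Continuous fun q : ℝ × ℝ => q.2 * y).continuousWithinAt
    filter_upwards [hv.eventually_lt_const hyc, self_mem_nhdsWithin] with q h1 h2
    exact (primalVal_le hL hp0 hp1 hU h2.1 h2.2 hy).trans_lt h1

end Primal

/-! ### The time change -/

section TimeChange

/-- The remaining variance `∫_t^T |θ̂(r)|² dr`, with `θ̂` extended continuously by constants
outside `[0,T]`. -/
noncomputable def remVar {n : ℕ} {T : ℝ} (hT : 0 < T) (θ : ℝ → Vec n) (t : ℝ) : ℝ :=
  ∫ r in t..T, ‖IccExtend hT.le ((Icc 0 T).domRestrict θ) r‖ ^ 2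

variable {n : ℕ} {T : ℝ} (hT : 0 < T) {θ : ℝ → Vec n} (hθ : ContinuousOn θ (Icc 0 T))
  {θ₀ : ℝ} (hθ₀ : 0 < θ₀) (hθb : ∀ t ∈ Icc 0 T, θ₀ ≤ ‖θ t‖)

lemma remVar_self : remVar hT θ T = 0 := by simp [remVar]

include hθ in
lemma continuous_speed :
    Continuous fun r => ‖IccExtend hT.le ((Icc 0 T).domRestrict θ) r‖ ^ 2 :=
  (hθ.domRestrict.Icc_extend' (h := hT.le)).norm.pow 2

include hθ in
lemma hasDerivAt_remVar (t : ℝ) : HasDerivAt (remVar hT θ)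
    (-‖IccExtend hT.le ((Icc 0 T).domRestrict θ) t‖ ^ 2) t :=
  have hc := continuous_speed hT hθ
  intervalIntegral.integral_hasDerivAt_left (hc.intervalIntegrable _ _)
    (hc.stronglyMeasurableAtFilter _ _) hc.continuousAt

include hθ hθ₀ hθb in
lemma remVar_pos {t : ℝ} (ht : t < T) : 0 < remVar hT θ t := by
  refine intervalIntegral.intervalIntegral_pos_of_pos
    ((continuous_speed hT hθ).intervalIntegrable _ _) (fun r => ?_) ht
  have : 0 < ‖IccExtend hT.le ((Icc 0 T).domRestrict θ) r‖ :=
    hθ₀.trans_le (hθb _ (projIcc 0 T hT.le r).2)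
  positivity

include hθ in
lemma remVar_le {t : ℝ} (ht : 0 ≤ t) : remVar hT θ t ≤ remVar hT θ 0 := by
  refine antitone_of_deriv_nonpos (fun t => (hasDerivAt_remVar hT hθ t).differentiableAt)
    (fun t => ?_) ht
  rw [(hasDerivAt_remVar hT hθ t).deriv]
  exact neg_nonpos.2 (sq_nonneg _)

end TimeChange

end UtilityHJB

/-! ### The value function -/

open UtilityHJB in
theorem theorem3p1 {n : ℕ} (T : ℝ) (hT : 0 < T)
    (K : ProperCone ℝ (UtilityHJB.Vec n))
    (b : ℝ → UtilityHJB.Vec n) (σ : ℝ → UtilityHJB.Mat n)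
    (hb : ContinuousOn b (Set.Icc 0 T)) (hσ : ContinuousOn σ (Set.Icc 0 T))
    (hσ_unit : ∀ t ∈ Set.Icc 0 T, IsUnit (σ t).det)
    (L p : ℝ) (hL : 0 < L) (hp0 : 0 < p) (hp1 : p < 1)
    (U : ℝ → ℝ) (hU : UtilityHJB.IsUtility L p U)
    (hθ_cont : ContinuousOn (UtilityHJB.thetaHat K b σ) (Set.Icc 0 T))
    (θ₀ : ℝ) (hθ₀ : 0 < θ₀)
    (hθ_bound : ∀ t ∈ Set.Icc 0 T, θ₀ ≤ ‖UtilityHJB.thetaHat K b σ t‖) :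
    ∃ u : ℝ → ℝ → ℝ,
      ContinuousOn (fun q : ℝ × ℝ => u q.1 q.2) (Set.Icc 0 T ×ˢ Set.Ici 0) ∧
      UtilityHJB.IsC12 T u ∧
      -- the HJB equation `-u_t - H(t, x, u_x, u_xx) = 0`
      (∀ t ∈ Set.Ico 0 T, ∀ x ∈ Set.Ioi (0 : ℝ),
        ((-UtilityHJB.dt T u t x : ℝ) : EReal) -
          UtilityHJB.hamiltonian K b σ t x (UtilityHJB.dx u t x) (UtilityHJB.dxx u t x) = 0) ∧
      -- the maximum of the Hamiltonian is attained at the feedback control, which lies in `K`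
      (∀ t ∈ Set.Ico 0 T, ∀ x ∈ Set.Ioi (0 : ℝ),
        UtilityHJB.dxx u t x < 0 ∧
        UtilityHJB.piStar K b σ u t x ∈ K ∧
        IsMaxOn
          (UtilityHJB.hamObj b σ t x (UtilityHJB.dx u t x) (UtilityHJB.dxx u t x))
          (K : Set (UtilityHJB.Vec n)) (UtilityHJB.piStar K b σ u t x)) ∧
      (∀ t ∈ Set.Ico 0 T, StrictMonoOn (fun x => u t x) (Set.Ici 0)) ∧
      (∀ t ∈ Set.Ico 0 T, StrictConcaveOn ℝ (Set.Ici 0) (fun x => u t x)) ∧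
      (∀ x ∈ Set.Ici (0 : ℝ), u T x = U x) ∧
      (∀ t ∈ Set.Icc 0 T, u t 0 = 0) ∧
      (∃ C : ℝ, ∀ t ∈ Set.Icc 0 T, ∀ x ∈ Set.Ici (0 : ℝ),
        0 ≤ u t x ∧ u t x ≤ C * (1 + x ^ p)) := by
  obtain ⟨v₁, v₂, v₃, hflow, hv₃⟩ := exists_convexFlow_conj hL hp0 hp1 hU
  set A : ℝ → ℝ := remVar hT (thetaHat K b σ) with hA
  have hA' := hasDerivAt_remVar hT hθ_cont
  have hAc : Continuous A := continuous_iff_continuousAt.2 fun t => (hA' t).continuousAt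
  have hApos : ∀ t < T, 0 < A t := fun t ht => remVar_pos hT hθ_cont hθ₀ hθ_bound ht
  have hAT : A T = 0 := remVar_self hT
  have hA0 : ∀ t ∈ Icc 0 T, 0 ≤ A t := fun t ht =>
    ht.2.eq_or_lt.elim (fun h => (h ▸ hAT).ge) fun h => (hApos t h).le
  set a : ℝ → ℝ := fun t => ‖IccExtend hT.le ((Icc 0 T).domRestrict (thetaHat K b σ)) t‖ ^ 2 with ha
  have hac : Continuous a := continuous_speed hT hθ_cont
  have haeq : ∀ t ∈ Ico 0 T, a t = ‖thetaHat K b σ t‖ ^ 2 := fun t ht => by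
    simp only [ha, IccExtend_of_mem _ _ (Ico_subset_Icc_self ht), domRestrict_apply]
  set u : ℝ → ℝ → ℝ := fun t x => primalVal U (A t) x with hu
  set Y : ℝ → ℝ → ℝ := fun t x => optPt v₁ (A t) x with hY
  -- all derivatives of `u` are expressed through the optimal dual point `Y = u_x`
  have hYpos : ∀ t ∈ Ico 0 T, ∀ x ∈ Ioi (0 : ℝ), 0 < Y t x := fun t ht x hx =>
    (hflow.optPt_spec (hApos t ht.2) hx).1
  have hux : ∀ t ∈ Ico 0 T, ∀ x ∈ Ioi (0 : ℝ), HasDerivAt (fun z => u t z) (Y t x) x :=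
    fun t ht x hx => hflow.hasDerivAt_legendre_space (hApos t ht.2) hx
  have hdx : ∀ t ∈ Ico 0 T, ∀ x ∈ Ioi (0 : ℝ), dx u t x = Y t x :=
    fun t ht x hx => (hux t ht x hx).deriv
  have huxx : ∀ t ∈ Ico 0 T, ∀ x ∈ Ioi (0 : ℝ),
      HasDerivAt (fun z => dx u t z) (-(v₂ (A t) (Y t x))⁻¹) x := fun t ht x hx =>
    (hflow.hasDerivAt_optPt (hApos t ht.2) hx).congr_of_eventuallyEq
      ((lt_mem_nhds hx).mono fun z hz => hdx t ht z hz)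
  have hdxx : ∀ t ∈ Ico 0 T, ∀ x ∈ Ioi (0 : ℝ), dxx u t x = -(v₂ (A t) (Y t x))⁻¹ :=
    fun t ht x hx => (huxx t ht x hx).deriv
  have hut : ∀ t ∈ Ico 0 T, ∀ x ∈ Ioi (0 : ℝ),
      HasDerivAt (fun r => u r x) (v₃ (A t) (Y t x) * -a t) t := fun t ht x hx =>
    (hflow.hasDerivAt_legendre_time (hApos t ht.2) hx).comp t (hA' t)
  have hdt : ∀ t ∈ Ico 0 T, ∀ x ∈ Ioi (0 : ℝ), dt T u t x = v₃ (A t) (Y t x) * -a t :=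
    fun t ht x hx => (hut t ht x hx).hasDerivWithinAt.derivWithin (uniqueDiffOn_Ico 0 T t ht)
  have hv₂ : ∀ t ∈ Ico 0 T, ∀ x ∈ Ioi (0 : ℝ), 0 < v₂ (A t) (Y t x) := fun t ht x hx =>
    hflow.pos _ (hApos t ht.2) _ (hYpos t ht x hx)
  have hneg : ∀ t ∈ Ico 0 T, ∀ x ∈ Ioi (0 : ℝ), dxx u t x < 0 := fun t ht x hx => by
    rw [hdxx t ht x hx]
    exact neg_neg_of_pos (inv_pos.2 (hv₂ t ht x hx))
  have hxpos : ∀ t ∈ Ico 0 T, ∀ x ∈ Ioi (0 : ℝ), 0 < dx u t x := fun t ht x hx =>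
    (hdx t ht x hx).symm ▸ hYpos t ht x hx
  have hunit : ∀ t ∈ Ico 0 T, IsUnit (σ t).det := fun t ht => hσ_unit t (Ico_subset_Icc_self ht)
  have hcont : ContinuousOn (fun q : ℝ × ℝ => u q.1 q.2) (Icc 0 T ×ˢ Ici 0) :=
    (continuousOn_primalVal hL hp0 hp1 hU).comp (f := fun q : ℝ × ℝ => (A q.1, q.2))
      (by fun_prop) fun q hq => ⟨hA0 q.1 hq.1, hq.2⟩
  have hYc : ContinuousOn (fun q : ℝ × ℝ => Y q.1 q.2) (Ico 0 T ×ˢ Ioi 0) := fun q hq =>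
    ((hflow.continuousAt_optPt (hApos q.1 hq.1.2) hq.2).comp (x := q)
      (f := fun q : ℝ × ℝ => (A q.1, q.2)) (by fun_prop)).continuousWithinAt
  have hAYc : ContinuousOn (fun q : ℝ × ℝ => (A q.1, Y q.1 q.2)) (Ico 0 T ×ˢ Ioi 0) :=
    (hAc.comp continuous_fst).continuousOn.prodMk hYc
  have hAYm : MapsTo (fun q : ℝ × ℝ => (A q.1, Y q.1 q.2)) (Ico 0 T ×ˢ Ioi 0) (Ioi 0 ×ˢ Ioi 0) :=
    fun q hq => ⟨hApos q.1 hq.1.2, hYpos q.1 hq.1 q.2 hq.2⟩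
  have hxc : ∀ t ∈ Ico 0 T, ContinuousOn (fun x => u t x) (Ici 0) := fun t ht =>
    hcont.comp (f := fun x : ℝ => (t, x)) (by fun_prop) fun x hx => ⟨Ico_subset_Icc_self ht, hx⟩
  refine ⟨u, hcont, ?_, fun t ht x hx => ?_, fun t ht x hx => ⟨hneg t ht x hx, ?_, ?_⟩,
    fun t ht => ?_, fun t ht => ?_, fun x hx => ?_, fun t ht => ?_, ?_⟩
  · exact {
      diff_t := fun t ht x hx => (hut t ht x hx).differentiableAt.differentiableWithinAt
      diff_x := fun t ht x hx => (hux t ht x hx).differentiableAt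
      diff_xx := fun t ht x hx => (huxx t ht x hx).differentiableAt
      cont := hcont.mono (prod_mono Ico_subset_Icc_self Ioi_subset_Ici_self)
      cont_t := ((hflow.cont_s.comp hAYc hAYm).mul
        (hac.comp continuous_fst).neg.continuousOn).congr fun q hq => hdt q.1 hq.1 q.2 hq.2
      cont_x := hYc.congr fun q hq => hdx q.1 hq.1 q.2 hq.2
      cont_xx := ((hflow.cont_yy.comp hAYc hAYm).inv₀
        fun q hq => (hv₂ q.1 hq.1 q.2 hq.2).ne').neg.congr fun q hq => hdxx q.1 hq.1 q.2 hq.2 }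
  · rw [hamiltonian_eq K b σ t (hunit t ht) hx (hxpos t ht x hx) (hneg t ht x hx),
      ← EReal.coe_sub, EReal.coe_eq_zero, hdt t ht x hx, hdxx t ht x hx, hdx t ht x hx,
      ← haeq t ht, hv₃ _ (hApos t ht.2) _ (hYpos t ht x hx)]
    have := (hv₂ t ht x hx).ne'
    field_simp
    ring
  · exact feedback_mem K b σ t (hunit t ht) hx (hxpos t ht x hx) (hneg t ht x hx)
  · intro π hπ
    refine (hamObj_le K b σ t (hunit t ht) hx (hxpos t ht x hx) (hneg t ht x hx) hπ).trans_eq ?_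
    exact (hamObj_feedback K b σ t (hunit t ht) hx (hneg t ht x hx)).symm
  · refine strictMonoOn_of_deriv_pos (convex_Ici 0) (hxc t ht) fun x hx => ?_
    rw [interior_Ici] at hx
    exact hxpos t ht x hx
  · refine strictConcaveOn_of_deriv2_neg (convex_Ici 0) (hxc t ht) fun x hx => ?_
    rw [interior_Ici] at hx
    exact hneg t ht x hx
  · simp only [hu, hAT]
    exact primalVal_zero_left hL hp0 hp1 hU hx
  · exact primalVal_zero_right hL hp0 hp1 hU (hA0 t ht)
  · obtain ⟨C, hC⟩ := primalVal_growth hL hp0 hp1 hU (A 0)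
    exact ⟨C, fun t ht x hx => ⟨(hU.growth x hx).1.trans
      (utility_le_primalVal hL hp0 hp1 hU (hA0 t ht) hx),
      hC _ (hA0 t ht) (remVar_le hT hθ_cont ht.1) x hx⟩⟩
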